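/- Consider the equation $\mathcal E=0$ for $u=u(x,t)$, where $$\mathcal E=u_t-u_{txx}-\bigl(16uu_x-8u_xu_{xx}+2u_{xx}^2-4uu_{xxx}+2u_xu_{xxx}\bigr).$$ Let $U$ be a connected, nonempty open subset of the second order jet space $\mathbb R^8$ with coordinates $(x,t,u,u_x,u_t,u_{xx},u_{tx},u_{tt})$ (for instance $U=\mathbb R^8$). Call a function $\phi$ on $U$ a characteristic of a conservation law, of order at most two, if $\phi$ is $C^\infty$ on $U$ and there are $C^\infty$ functions $C^0,C^1$ of $x$, $t$, $u$ and finitely many derivatives of $u$, defined over $U$ (that is, at all jets whose second order part lies in $U$), such that $$D_tC^0+D_xC^1=\phi\,\mathcal E$$ holds identically over $U$ in the jet variables, where $D_t$ and $D_x$ are the total derivatives. Then the characteristics of order at most two are exactly the real linear combinations, with constant coefficients, of $$\phi_1=1,\qquad \phi_2=e^{2x},\qquad \phi_3=u,$$ $$\phi_4=-4u^{2}+u_{x}^{2}+2uu_{xx}-u_{x}u_{xx}-\tfrac12u_{tx},$$ $$\phi_5=e^{-2x}\left(3u^{2}-4uu_{x}-u_{x}^{2}+u_{t}-4uu_{xx}+2u_{x}u_{xx}+u_{tx}\right),$$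 and these five functions are linearly independent on $U$, so that they form a basis of the space of characteristics of order at most two. -/

import Mathlib

open scoped ContDiff

noncomputable section

namespace NovikovCL

/-- Multi-indices `(i, j)` of total order at most `n`; the index `(i, j)` stands for the derivative
`∂_x^i ∂_t^j u`. -/
abbrev MultiIdx (n : ℕ) : Type := {a : ℕ × ℕ // a.1 + a.2 ≤ n}

instance (n : ℕ) : Fintype (MultiIdx n) :=
  Fintype.subtype
    ((Finset.range (n + 1) ×ˢ Finset.range (n + 1)).filter (fun a => a.1 + a.2 ≤ n))
    (by
      intro a
      simp only [Finset.mem_filter, Finset.mem_product, Finset.mem_range]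
      omega)

/-- The jet space of order `n` for one dependent variable `u` and two independent variables
`x, t`. A point is `(x, t, (u_a)_a)`, the derivative coordinates `u_a` being independent. -/
abbrev Jet (n : ℕ) : Type := ℝ × ℝ × (MultiIdx n → ℝ)

/-- The coordinate `∂_x^i ∂_t^j u` of a jet. -/
def Jet.d {n : ℕ} (z : Jet n) (i j : ℕ) (h : i + j ≤ n := by norm_num) : ℝ := z.2.2 ⟨(i, j), h⟩

/-- The projection of jets of order `n` to jets of order `m ≤ n`, forgetting the derivatives of
order greater than `m`. -/
def Jet.proj {m n : ℕ} (h : m ≤ n) (z : Jet n) : Jet m :=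
  (z.1, z.2.1, fun a => z.2.2 ⟨a.1, a.2.trans h⟩)

/-- The total derivative with respect to `x`:
`D_x F = ∂F/∂x + ∑_{(i, j)} u_{(i + 1, j)} ∂F/∂u_{(i, j)}`, written as the derivative of `F` in the
direction `(1, 0, (u_{(i + 1, j)})_{(i, j)})`. -/
def totalDx {n : ℕ} (F : Jet n → ℝ) (z : Jet (n + 1)) : ℝ :=
  fderiv ℝ F (z.proj (Nat.le_succ n))
    (1, 0, fun a => z.d (a.1.1 + 1) a.1.2 (by have := a.2; omega))

/-- The total derivative with respect to `t`:
`D_t F = ∂F/∂t + ∑_{(i, j)} u_{(i, j + 1)} ∂F/∂u_{(i, j)}`. -/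
def totalDt {n : ℕ} (F : Jet n → ℝ) (z : Jet (n + 1)) : ℝ :=
  fderiv ℝ F (z.proj (Nat.le_succ n))
    (0, 1, fun a => z.d a.1.1 (a.1.2 + 1) (by have := a.2; omega))

/-- The differential function
`u_t - u_{txx} - (16 u u_x - 8 u_x u_{xx} + 2 u_{xx}^2 - 4 u u_{xxx} + 2 u_x u_{xxx})`,
whose vanishing is the equation. -/
def eqn (z : Jet 3) : ℝ :=
  z.d 0 1 - z.d 2 1
    - (16 * z.d 0 0 * z.d 1 0 - 8 * z.d 1 0 * z.d 2 0 + 2 * z.d 2 0 ^ 2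
        - 4 * z.d 0 0 * z.d 3 0 + 2 * z.d 1 0 * z.d 3 0)

/-- `φ` is, on the open set `U` of the second order jet space, the characteristic of a conservation
law of the equation: `φ` is smooth on `U`, and there are smooth differential functions `C⁰`, `C¹`
of some finite order over `U` with `D_t C⁰ + D_x C¹ = φ · eqn` identically, that is, at all jets
over `U` and not only at those of solutions. (A function of order less than 2 is also a function
of order 2, so it is no restriction to write the order of the currents as `k + 2`.) -/
def IsCharacteristicOn (U : Set (Jet 2)) (φ : Jet 2 → ℝ) : Prop :=
  ContDiffOn ℝ ∞ φ U ∧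
  ∃ (k : ℕ) (C₀ C₁ : Jet (k + 2) → ℝ),
    ContDiffOn ℝ ∞ C₀ {z | z.proj (by omega) ∈ U} ∧
    ContDiffOn ℝ ∞ C₁ {z | z.proj (by omega) ∈ U} ∧
    ∀ z : Jet (k + 2 + 1), z.proj (by omega) ∈ U →
      totalDt C₀ z + totalDx C₁ z = φ (z.proj (by omega)) * eqn (z.proj (by omega))

/-- The five functions `1`, `e^{2x}`, `u`, `φ₄`, `φ₅`. -/
def listed : Fin 5 → Jet 2 → ℝ :=
  ![fun _ => 1,
    fun z => Real.exp (2 * z.1),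
    fun z => z.d 0 0,
    fun z => -4 * z.d 0 0 ^ 2 + z.d 1 0 ^ 2 + 2 * z.d 0 0 * z.d 2 0 - z.d 1 0 * z.d 2 0
      - 1 / 2 * z.d 1 1,
    fun z => Real.exp (-2 * z.1) *
      (3 * z.d 0 0 ^ 2 - 4 * z.d 0 0 * z.d 1 0 - z.d 1 0 ^ 2 + z.d 0 1
        - 4 * z.d 0 0 * z.d 2 0 + 2 * z.d 1 0 * z.d 2 0 + z.d 1 1)]

end NovikovCL

end

open scoped ContDiff

set_option linter.unusedSectionVars false
set_option linter.unusedSimpArgs false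

noncomputable section

namespace NovikovCL

/-! The Euler operator annihilates total divergences, so a characteristic F satisfies `eulerMul F =
0`. As F has order two, higher jet coordinates enter this identity polynomially, and partial
derivatives in them split it into linear differential equations for F on the second jet space.
Below, F_a denotes the derivative of F in the coordinate a.

The top coefficients say that F_{u_tt} is killed by the field `fieldXX` and by `fieldDx`, the total
x-derivative with u_txx eliminated through the equation. It is then killed by their iterated
commutators `fieldX` and `fieldU`, and so depends on t alone (`pd_pd_tt_and_px_pd_tt`). The same
commutators applied to F_{u_tx} and F_{u_t}, together with the u_tt-coefficient `pd_tt_euler`, force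
F_{u_tt} = 0 and make F_{u_t}, F_{u_tx} functions of x and t (`pd_tt_eq_zero`,
`pd_pd_t_and_pd_pd_tx`). Lower coefficients give F_{u_x} and F_{u_xx} in terms of these two
(`pd_x_eq`, `pd_xx_eq`), the laws ∂_x F_{u_t} = −2F_{u_t} and ∂_x F_{u_tx} = −2F_{u_t}, and
independence of t. Hence F_{u_t} is a multiple of e^{−2x} and F_{u_t} − F_{u_tx} is constant.
Subtracting multiples of φ₅ and φ₄ removes both derivatives, and what remains is a combination of 1,
e^{2x} and u (`derivatives_of_pd_t_eq_zero`).

This elimination is carried out in an abstract `JetCalculus`, realised by smooth functions on an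
open set of a jet space of finite order N (`jetCalculus`). Connectedness turns vanishing derivatives
into constants. The converse rests on explicit currents of order two, which also show that the Euler
operator kills φ₄ and φ₅. -/

/-- A commutative algebra of differential functions with coordinates `u i j` standing for
`∂_x^i ∂_t^j u`, partial derivatives `pd i j` with respect to them, explicit partial derivatives
`px`, `pt`, and total derivatives `Dx`, `Dt`. The laws are required up to jet order six. -/
structure JetCalculus (R : Type*) [CommRing R] [Algebra ℝ R] where
  u : ℕ → ℕ → R
  pd : ℕ → ℕ → Derivation ℝ R R
  px : Derivation ℝ R R
  pt : Derivation ℝ R R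
  Dx : Derivation ℝ R R
  Dt : Derivation ℝ R R
  pd_comm : ∀ i j k l f, pd i j (pd k l f) = pd k l (pd i j f)
  px_pd : ∀ i j f, px (pd i j f) = pd i j (px f)
  pt_pd : ∀ i j f, pt (pd i j f) = pd i j (pt f)
  pt_px : ∀ f, pt (px f) = px (pt f)
  pd_u : ∀ i j k l, k + l ≤ 6 → pd i j (u k l) = if i = k ∧ j = l then 1 else 0
  px_u : ∀ i j, px (u i j) = 0
  pt_u : ∀ i j, pt (u i j) = 0
  Dx_u : ∀ i j, i + j ≤ 5 → Dx (u i j) = u (i + 1) j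
  Dt_u : ∀ i j, i + j ≤ 5 → Dt (u i j) = u i (j + 1)
  pd_Dx : ∀ i j f, i + j ≤ 6 → pd i j (Dx f) = Dx (pd i j f) + if i = 0 then 0 else pd (i - 1) j f
  pd_Dt : ∀ i j f, i + j ≤ 6 → pd i j (Dt f) = Dt (pd i j f) + if j = 0 then 0 else pd i (j - 1) f
  Dx_eq : ∀ f, (∀ i j, 3 ≤ i + j → pd i j f = 0) →
    Dx f = px f + u 1 0 * pd 0 0 f + u 2 0 * pd 1 0 f + u 1 1 * pd 0 1 f
      + u 3 0 * pd 2 0 f + u 2 1 * pd 1 1 f + u 1 2 * pd 0 2 f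
  Dt_eq : ∀ f, (∀ i j, 3 ≤ i + j → pd i j f = 0) →
    Dt f = pt f + u 0 1 * pd 0 0 f + u 1 1 * pd 1 0 f + u 0 2 * pd 0 1 f
      + u 2 1 * pd 2 0 f + u 1 2 * pd 1 1 f + u 0 3 * pd 0 2 f

/-! ### Functions of order at most two and the Euler operator. -/

namespace JetCalculus

variable {R : Type*} [CommRing R] [Algebra ℝ R] (J : JetCalculus R)

/-- `f` depends on the jet coordinates of order at most two only. -/
def LowOrder (f : R) : Prop := ∀ i j, 3 ≤ i + j → J.pd i j f = 0

lemma derivation_ofNat (D : Derivation ℝ R R) (n : ℕ) [n.AtLeastTwo] :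
    D (ofNat(n) : R) = 0 := by
  rw [← Nat.cast_ofNat (R := R) (n := n)]
  exact D.map_natCast _

variable {J}

lemma LowOrder.pd {f : R} (h : J.LowOrder f) (k l : ℕ) : J.LowOrder (J.pd k l f) := by
  intro i j hij
  rw [J.pd_comm, h i j hij, map_zero]

lemma LowOrder.px {f : R} (h : J.LowOrder f) : J.LowOrder (J.px f) := by
  intro i j hij
  rw [← J.px_pd, h i j hij, map_zero]

lemma LowOrder.pt {f : R} (h : J.LowOrder f) : J.LowOrder (J.pt f) := by
  intro i j hij
  rw [← J.pt_pd, h i j hij, map_zero]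

variable (J)

/-- The left-hand side of the equation. -/
def novikov : R :=
  J.u 0 1 - J.u 2 1 - (16 * J.u 0 0 * J.u 1 0 - 8 * J.u 1 0 * J.u 2 0 + 2 * J.u 2 0 * J.u 2 0
    - 4 * J.u 0 0 * J.u 3 0 + 2 * J.u 1 0 * J.u 3 0)

/-- The Euler operator applied to `f * novikov`, for `f` of order at most two. -/
def eulerMul (f : R) : R :=
  J.pd 0 0 (f * J.novikov) - J.Dx (J.pd 1 0 (f * J.novikov)) - J.Dt (J.pd 0 1 (f * J.novikov))
    + J.Dx (J.Dx (J.pd 2 0 (f * J.novikov))) + J.Dx (J.Dt (J.pd 1 1 (f * J.novikov)))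
    + J.Dt (J.Dt (J.pd 0 2 (f * J.novikov))) - J.Dx (J.Dx (J.Dx (J.pd 3 0 (f * J.novikov))))
    - J.Dx (J.Dx (J.Dt (J.pd 2 1 (f * J.novikov))))

lemma pd_novikov (i j : ℕ) : J.pd i j J.novikov =
    (if i = 0 ∧ j = 0 then -16 * J.u 1 0 + 4 * J.u 3 0 else 0)
    + (if i = 1 ∧ j = 0 then -16 * J.u 0 0 + 8 * J.u 2 0 - 2 * J.u 3 0 else 0)
    + (if i = 2 ∧ j = 0 then 8 * J.u 1 0 - 4 * J.u 2 0 else 0)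
    + (if i = 3 ∧ j = 0 then 4 * J.u 0 0 - 2 * J.u 1 0 else 0)
    + (if i = 0 ∧ j = 1 then 1 else 0) + (if i = 2 ∧ j = 1 then -1 else 0) := by
  simp [novikov, derivation_ofNat, J.pd_u]
  split_ifs <;> first | omega | ring

/-- The first terms are the formal adjoint of the linearised equation applied to f. It has no term
of order zero in f, because 1 is a characteristic. The remaining terms are the adjoint of the
linearisation of f applied to the equation. -/
lemma eulerMul_eq {f : R} (hf : J.LowOrder f) : J.eulerMul f =
    -J.Dt f + J.Dx (J.Dx (J.Dt f)) + (16 * J.u 0 0 - 4 * J.u 2 0) * J.Dx f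
    + (2 * J.u 2 0 - 4 * J.u 1 0) * J.Dx (J.Dx f)
    - (4 * J.u 0 0 - 2 * J.u 1 0) * J.Dx (J.Dx (J.Dx f))
    + J.pd 0 0 f * J.novikov - J.Dx (J.pd 1 0 f * J.novikov) - J.Dt (J.pd 0 1 f * J.novikov)
    + J.Dx (J.Dx (J.pd 2 0 f * J.novikov)) + J.Dx (J.Dt (J.pd 1 1 f * J.novikov))
    + J.Dt (J.Dt (J.pd 0 2 f * J.novikov)) := by
  unfold eulerMul
  simp [derivation_ofNat, J.pd_novikov, hf 3 0, hf 2 1, J.Dx_u]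
  ring

end JetCalculus

/-! ### Vector fields on the second jet space and their commutators. -/

namespace JetCalculus

variable {R : Type*} [CommRing R] [Algebra ℝ R] (J : JetCalculus R)

/-- Normal ordering of second partial derivatives. -/
lemma pd_sort :
    (∀ f, J.pd 0 2 (J.pd 1 1 f) = J.pd 1 1 (J.pd 0 2 f)) ∧
    (∀ f, J.pd 0 2 (J.pd 0 1 f) = J.pd 0 1 (J.pd 0 2 f)) ∧
    (∀ f, J.pd 0 2 (J.pd 2 0 f) = J.pd 2 0 (J.pd 0 2 f)) ∧
    (∀ f, J.pd 0 2 (J.pd 1 0 f) = J.pd 1 0 (J.pd 0 2 f)) ∧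
    (∀ f, J.pd 0 2 (J.pd 0 0 f) = J.pd 0 0 (J.pd 0 2 f)) ∧
    (∀ f, J.pd 1 1 (J.pd 0 1 f) = J.pd 0 1 (J.pd 1 1 f)) ∧
    (∀ f, J.pd 1 1 (J.pd 2 0 f) = J.pd 2 0 (J.pd 1 1 f)) ∧
    (∀ f, J.pd 1 1 (J.pd 1 0 f) = J.pd 1 0 (J.pd 1 1 f)) ∧
    (∀ f, J.pd 1 1 (J.pd 0 0 f) = J.pd 0 0 (J.pd 1 1 f)) ∧
    (∀ f, J.pd 0 1 (J.pd 2 0 f) = J.pd 2 0 (J.pd 0 1 f)) ∧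
    (∀ f, J.pd 0 1 (J.pd 1 0 f) = J.pd 1 0 (J.pd 0 1 f)) ∧
    (∀ f, J.pd 0 1 (J.pd 0 0 f) = J.pd 0 0 (J.pd 0 1 f)) ∧
    (∀ f, J.pd 2 0 (J.pd 1 0 f) = J.pd 1 0 (J.pd 2 0 f)) ∧
    (∀ f, J.pd 2 0 (J.pd 0 0 f) = J.pd 0 0 (J.pd 2 0 f)) ∧
    (∀ f, J.pd 1 0 (J.pd 0 0 f) = J.pd 0 0 (J.pd 1 0 f)) := by
  refine ⟨?_, ?_, ?_, ?_, ?_, ?_, ?_, ?_, ?_, ?_, ?_, ?_, ?_, ?_, ?_⟩ <;>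
    exact fun f => J.pd_comm _ _ _ _ f

/-- The vector field `∂_{u_xx} + (4u - 2u_x) ∂_{u_tx}`. -/
def fieldXX : Derivation ℝ R R := J.pd 2 0 + (4 * J.u 0 0 - 2 * J.u 1 0) • J.pd 1 1

/-- The total `x`-derivative on functions of order one, extended so that `u_txx` is eliminated by
the equation and `u_xxx` by `fieldXX`. -/
def fieldDx : Derivation ℝ R R :=
  J.px + J.u 1 0 • J.pd 0 0 + J.u 2 0 • J.pd 1 0 + J.u 1 1 • J.pd 0 1
    + (J.u 0 1 - 16 * J.u 0 0 * J.u 1 0 + 8 * J.u 1 0 * J.u 2 0 - 2 * J.u 2 0 * J.u 2 0) • J.pd 1 1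

/-- The commutator of `fieldXX` and `fieldDx`. -/
def fieldX : Derivation ℝ R R :=
  J.pd 1 0 + (4 * J.u 0 0 - 2 * J.u 1 0) • J.pd 0 1 + (4 * J.u 1 0 - 2 * J.u 2 0) • J.pd 1 1

/-- The commutator of `fieldX` and `fieldDx`. -/
def fieldU : Derivation ℝ R R :=
  J.pd 0 0 + (-12 * J.u 0 0 - 2 * J.u 1 0 + 4 * J.u 2 0) • J.pd 1 1

lemma fieldXX_fieldDx (z : R) :
    J.fieldXX (J.fieldDx z) - J.fieldDx (J.fieldXX z) = J.fieldX z := by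
  simp [fieldXX, fieldDx, fieldX, derivation_ofNat, J.pd_u, J.px_u, J.px_pd, J.pd_comm]
  ring

lemma fieldX_fieldDx (z : R) :
    J.fieldX (J.fieldDx z) - J.fieldDx (J.fieldX z) = J.fieldU z := by
  simp [fieldU, fieldDx, fieldX, derivation_ofNat, J.pd_u, J.px_u, J.px_pd, J.pd_comm]
  ring

/-- This commutator involves only ∂_{u_t} and ∂_{u_tx}, so for a function killed by both fields it
relates these two derivatives directly. -/
lemma fieldX_fieldU (z : R) :
    J.fieldX (J.fieldU z) - J.fieldU (J.fieldX z) = -2 * J.pd 1 1 z - 4 * J.pd 0 1 z := by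
  simp [fieldU, fieldX, derivation_ofNat, J.pd_u, J.pd_comm]
  ring

lemma pd_fieldDx_t (z : R) : J.pd 0 1 (J.fieldDx z) = J.fieldDx (J.pd 0 1 z) + J.pd 1 1 z := by
  simp [fieldDx, derivation_ofNat, J.pd_u, J.px_pd, J.pd_comm]
  ring

lemma pd_fieldDx_tx (z : R) : J.pd 1 1 (J.fieldDx z) = J.fieldDx (J.pd 1 1 z) + J.pd 0 1 z := by
  simp [fieldDx, derivation_ofNat, J.pd_u, J.px_pd, J.pd_comm]
  ring

lemma fieldU_fieldDx (z : R) :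
    J.fieldU (J.fieldDx z) - J.fieldDx (J.fieldU z) = (2 * J.u 2 0 - 4 * J.u 1 0) * J.pd 1 1 z
      + (-12 * J.u 0 0 - 2 * J.u 1 0 + 4 * J.u 2 0) * J.pd 0 1 z := by
  simp [fieldU, fieldDx, derivation_ofNat, J.pd_u, J.px_u, J.px_pd, J.pd_comm]
  ring

lemma pd_fieldXX (z : R) : J.pd 0 1 (J.fieldXX z) = J.fieldXX (J.pd 0 1 z) := by
  simp [fieldXX, derivation_ofNat, J.pd_u, J.pd_comm]

lemma pd_fieldX (z : R) : J.pd 0 1 (J.fieldX z) = J.fieldX (J.pd 0 1 z) := by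
  simp [fieldX, derivation_ofNat, J.pd_u, J.pd_comm]

lemma pd_fieldU (z : R) : J.pd 0 1 (J.fieldU z) = J.fieldU (J.pd 0 1 z) := by
  simp [fieldU, derivation_ofNat, J.pd_u, J.pd_comm]

variable {J}

/-- The equation contains u_txx with coefficient −1, so adding its multiple by z_{u_tx} eliminates
u_txx. The coefficient of u_xxx is then `fieldXX z`, and that of u_ttx is z_{u_tt}. -/
lemma Dx_add_novikov_mul {z : R} (hz : J.LowOrder z) (h : J.fieldXX z = 0) (hw : J.pd 0 2 z = 0) :
    J.Dx z + J.novikov * J.pd 1 1 z = J.fieldDx z := by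
  simp only [fieldXX, Derivation.add_apply, Derivation.smul_apply, smul_eq_mul] at h
  rw [J.Dx_eq z hz, hw]
  simp only [fieldDx, novikov, Derivation.add_apply, Derivation.smul_apply, smul_eq_mul]
  linear_combination J.u 3 0 * h

/-- R may have zero divisors, but a numeral acts as a nonzero real scalar. -/
lemma eq_zero_of_ofNat_mul {n : ℕ} [n.AtLeastTwo] {y : R} (h : (ofNat(n) : R) * y = 0) : y = 0 := by
  have h1 : ((n : ℝ)) • y = 0 := by
    rw [Algebra.smul_def, map_natCast, ← Nat.cast_ofNat (R := R) (n := n)] at *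
    exact h
  rcases smul_eq_zero.mp h1 with h2 | h2
  · have := Nat.AtLeastTwo.prop (n := n)
    exfalso
    norm_cast at h2
    omega
  · exact h2

end JetCalculus

/-! ### The top coefficients: dependence on u_tt, u_tx and u_t. -/

namespace JetCalculus

variable {R : Type*} [CommRing R] [Algebra ℝ R] {J : JetCalculus R} {F : R}

section TimeDerivatives

variable (hF : J.LowOrder F) (hE : J.eulerMul F = 0)
include hF hE

/-- The coefficient of u_xxtt·u_ttt in the Euler identity. The lemmas below use other coefficients
in the same way, simplified by the relations already found. -/
lemma pd_tt_pd_tt : J.pd 0 2 (J.pd 0 2 F) = 0 := by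
  have h := congrArg (J.pd 0 3) (congrArg (J.pd 2 2) hE)
  simp [J.eulerMul_eq hF, derivation_ofNat, J.pd_novikov, J.pd_Dx, J.pd_Dt, J.pd_u, hF _ _,
    (hF.pd _ _) _ _, ((hF.pd _ _).pd _ _) _ _, J.pd_sort] at h
  exact h

lemma fieldXX_pd_tt : J.fieldXX (J.pd 0 2 F) = 0 := by
  have h := congrArg (J.pd 0 3) (congrArg (J.pd 4 0) hE)
  simp [J.eulerMul_eq hF, derivation_ofNat, J.pd_novikov, J.pd_Dx, J.pd_Dt, J.pd_u, hF _ _,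
    (hF.pd _ _) _ _, ((hF.pd _ _).pd _ _) _ _, J.pd_sort] at h
  simp only [fieldXX, Derivation.add_apply, Derivation.smul_apply, smul_eq_mul]
  linear_combination h

lemma fieldDx_pd_tt : J.fieldDx (J.pd 0 2 F) = 0 := by
  rw [← Dx_add_novikov_mul (hF.pd _ _) (fieldXX_pd_tt hF hE) (pd_tt_pd_tt hF hE)]
  have h := congrArg (J.pd 1 3) hE
  simp [J.eulerMul_eq hF, derivation_ofNat, J.pd_novikov, J.pd_Dx, J.pd_Dt, J.pd_u, hF _ _,
    (hF.pd _ _) _ _, J.pd_sort] at h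
  refine eq_zero_of_ofNat_mul (n := 2) ?_
  linear_combination h

/-- A function killed by `fieldXX` and `fieldDx` is killed by every field they generate. The
generated fields, with ∂_{u_tt} and the brackets of `fieldDx` with ∂_{u_t} and ∂_{u_tx}, leave only
dependence on t. -/
lemma pd_pd_tt_and_px_pd_tt :
    (∀ i j, J.pd i j (J.pd 0 2 F) = 0) ∧ J.px (J.pd 0 2 F) = 0 := by
  have h0 := pd_tt_pd_tt hF hE
  have h1 := fieldXX_pd_tt hF hE
  have h2 := fieldDx_pd_tt hF hE
  have hlow := hF.pd 0 2
  generalize J.pd 0 2 F = a at *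
  have h3 := J.fieldXX_fieldDx a
  rw [h1, h2, map_zero, map_zero, sub_zero] at h3
  have h4 := J.fieldX_fieldDx a
  rw [h2, ← h3, map_zero, map_zero, sub_zero] at h4
  have h5 := J.fieldX_fieldU a
  rw [← h3, ← h4, map_zero, map_zero, sub_zero] at h5
  have h6 := J.pd_fieldDx_t a
  have h7 := J.pd_fieldDx_tx a
  rw [h2, map_zero] at h6 h7
  have h8 : J.pd 1 1 a = -2 * J.pd 0 1 a := by
    have := eq_zero_of_ofNat_mul (n := 2) (y := J.pd 1 1 a + 2 * J.pd 0 1 a)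
      (by linear_combination h5)
    linear_combination this
  -- With q = ∂_{u_t}a and ∂_{u_tx}a = −2q, the two brackets with D = `fieldDx` read Dq = 2q and 2Dq
  -- = q.
  have hq : J.pd 0 1 a = 0 := by
    rw [h8] at h6 h7
    simp [derivation_ofNat] at h7
    refine eq_zero_of_ofNat_mul (n := 3) ?_
    linear_combination h7 + 2 * h6
  have hs : J.pd 1 1 a = 0 := by rw [h8, hq, mul_zero]
  simp [fieldXX, fieldX, fieldU, hq, hs] at h1 h3 h4
  refine ⟨fun i j => ?_, ?_⟩
  · by_cases h : 3 ≤ i + j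
    · exact hlow i j h
    · have : i ≤ 2 := by omega
      have : j ≤ 2 := by omega
      interval_cases i <;> interval_cases j <;>
        first | assumption | exact h3.symm | exact h4.symm | omega
  · simpa [fieldDx, hq, hs, ← h3, ← h4] using h2

lemma pd_pd_tt (i j : ℕ) : J.pd i j (J.pd 0 2 F) = 0 := (pd_pd_tt_and_px_pd_tt hF hE).1 i j

lemma px_pd_tt : J.px (J.pd 0 2 F) = 0 := (pd_pd_tt_and_px_pd_tt hF hE).2

lemma pd_pt_pd_tt (i j : ℕ) : J.pd i j (J.pt (J.pd 0 2 F)) = 0 := by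
  rw [← J.pt_pd, pd_pd_tt hF hE, map_zero]

lemma px_pt_pd_tt : J.px (J.pt (J.pd 0 2 F)) = 0 := by
  rw [← J.pt_px, px_pd_tt hF hE, map_zero]

lemma Dx_pd_tt : J.Dx (J.pd 0 2 F) = 0 := by
  simp [J.Dx_eq _ (hF.pd 0 2), pd_pd_tt hF hE, px_pd_tt hF hE]

lemma Dt_pd_tt : J.Dt (J.pd 0 2 F) = J.pt (J.pd 0 2 F) := by
  simp [J.Dt_eq _ (hF.pd 0 2), pd_pd_tt hF hE]

lemma Dx_pt_pd_tt : J.Dx (J.pt (J.pd 0 2 F)) = 0 := by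
  simp [J.Dx_eq _ (hF.pd 0 2).pt, pd_pt_pd_tt hF hE, px_pt_pd_tt hF hE]

lemma fieldXX_pd_tx : J.fieldXX (J.pd 1 1 F) = 0 := by
  have h := congrArg (J.pd 4 0) (congrArg (J.pd 1 2) hE)
  simp [J.eulerMul_eq hF, derivation_ofNat, J.pd_novikov, J.pd_Dx, J.pd_Dt, J.pd_u, hF _ _,
    (hF.pd _ _) _ _, ((hF.pd _ _).pd _ _) _ _, J.pd_sort, pd_pd_tt hF hE] at h
  simp only [fieldXX, Derivation.add_apply, Derivation.smul_apply, smul_eq_mul]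
  linear_combination h

lemma Dx_pd_tx : J.Dx (J.pd 1 1 F) + J.novikov * J.pd 1 1 (J.pd 1 1 F) =
    -2 * J.pd 0 1 F - (4 * J.u 1 0 - 2 * J.u 2 0) * J.pd 0 2 F + J.pt (J.pd 0 2 F) := by
  have h := congrArg (J.pd 2 2) hE
  simp [J.eulerMul_eq hF, derivation_ofNat, J.pd_novikov, J.pd_Dx, J.pd_Dt, J.pd_u, hF _ _,
    (hF.pd _ _) _ _, ((hF.pd _ _).pd _ _) _ _, J.pd_sort, pd_pd_tt hF hE, Dx_pd_tt hF hE,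
    Dt_pd_tt hF hE, pd_pt_pd_tt hF hE] at h
  linear_combination h

lemma fieldDx_pd_tx : J.fieldDx (J.pd 1 1 F) =
    -2 * J.pd 0 1 F - (4 * J.u 1 0 - 2 * J.u 2 0) * J.pd 0 2 F + J.pt (J.pd 0 2 F) := by
  rw [← Dx_pd_tx hF hE, Dx_add_novikov_mul (hF.pd _ _) (fieldXX_pd_tx hF hE)
    (by simp [J.pd_sort, pd_pd_tt hF hE])]

lemma fieldXX_pd_t : J.fieldXX (J.pd 0 1 F) = 0 := by
  have h := congrArg (J.pd 0 2) (congrArg (J.pd 4 0) hE)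
  simp [J.eulerMul_eq hF, derivation_ofNat, J.pd_novikov, J.pd_Dx, J.pd_Dt, J.Dt_u, J.pd_u, hF _ _,
    (hF.pd _ _) _ _, ((hF.pd _ _).pd _ _) _ _, J.pd_sort, pd_pd_tt hF hE] at h
  simp only [fieldXX, Derivation.add_apply, Derivation.smul_apply, smul_eq_mul]
  rw [J.pd_comm 1 1]
  linear_combination h

lemma fieldX_self : J.fieldX F = -(4 * J.u 0 1 - 2 * J.u 1 1) * J.pd 0 2 F
    - (4 * J.u 0 0 - 2 * J.u 1 0) * (4 * J.u 1 0 - 2 * J.u 2 0) * J.pd 0 2 F := by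
  have h := congrArg (J.pd 3 1) hE
  have h1 := fieldXX_pd_tx hF hE
  have h2 := Dx_pd_tx hF hE
  simp only [fieldXX, Derivation.add_apply, Derivation.smul_apply, smul_eq_mul] at h1
  simp [J.eulerMul_eq hF, derivation_ofNat, J.pd_novikov, J.pd_Dx, J.pd_Dt, J.Dx_u, J.Dt_u, J.pd_u,
    hF _ _, (hF.pd _ _) _ _, ((hF.pd _ _).pd _ _) _ _, J.pd_sort, pd_pd_tt hF hE, Dx_pd_tt hF hE,
    Dt_pd_tt hF hE, pd_pt_pd_tt hF hE] at h
  simp only [fieldX, Derivation.add_apply, Derivation.smul_apply, smul_eq_mul]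
  rw [← sub_eq_zero]
  refine eq_zero_of_ofNat_mul (n := 2) ?_
  linear_combination h - 2 * J.novikov * h1 + 2 * (4 * J.u 0 0 - 2 * J.u 1 0) * h2

lemma fieldX_pd_t : J.fieldX (J.pd 0 1 F) = -4 * J.pd 0 2 F := by
  have h := congrArg (J.pd 0 1) (fieldX_self hF hE)
  simp [fieldX, derivation_ofNat, J.pd_u, pd_pd_tt hF hE] at h
  simp only [fieldX, Derivation.add_apply, Derivation.smul_apply, smul_eq_mul]
  rw [J.pd_comm 1 0, J.pd_comm 1 1]
  linear_combination h

/-- F_{u_tx} is not killed by `fieldDx`, but its image is known explicitly, so the bracket of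
`fieldXX` and `fieldDx` can still be evaluated on it. `fieldU_pd_tx` repeats this one bracket
further. -/
lemma fieldX_pd_tx : J.fieldX (J.pd 1 1 F) = 2 * J.pd 0 2 F := by
  have h := J.fieldXX_fieldDx (J.pd 1 1 F)
  have h1 := fieldXX_pd_t hF hE
  rw [fieldXX_pd_tx hF hE, fieldDx_pd_tx hF hE] at h
  simp only [fieldXX, Derivation.add_apply, Derivation.smul_apply, smul_eq_mul] at h1
  simp [fieldXX, derivation_ofNat, J.pd_u, pd_pd_tt hF hE, pd_pt_pd_tt hF hE] at h
  linear_combination -h - 2 * h1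

lemma fieldU_pd_tx : J.fieldU (J.pd 1 1 F) = 4 * J.pd 0 2 F := by
  have h := J.fieldX_fieldDx (J.pd 1 1 F)
  have h1 := fieldX_pd_t hF hE
  rw [fieldX_pd_tx hF hE, fieldDx_pd_tx hF hE] at h
  simp only [fieldX, Derivation.add_apply, Derivation.smul_apply, smul_eq_mul] at h1
  simp [fieldX, fieldDx, derivation_ofNat, J.pd_u, pd_pd_tt hF hE, pd_pt_pd_tt hF hE,
    px_pd_tt hF hE] at h
  linear_combination -h - 2 * h1

lemma pd_tx_pd_tx_eq : J.pd 1 1 (J.pd 1 1 F) = -2 * J.pd 0 1 (J.pd 1 1 F) := by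
  have h := J.fieldX_fieldU (J.pd 1 1 F)
  rw [fieldX_pd_tx hF hE, fieldU_pd_tx hF hE] at h
  simp [fieldX, fieldU, derivation_ofNat, pd_pd_tt hF hE] at h
  have := eq_zero_of_ofNat_mul (n := 2) (y := J.pd 1 1 (J.pd 1 1 F) + 2 * J.pd 0 1 (J.pd 1 1 F))
    (by linear_combination h)
  linear_combination this

/-- The brackets of `fieldDx` with ∂_{u_t} and ∂_{u_tx}, evaluated on F_{u_tx}, give two linear
equations for F_{u_t u_tx}, its `fieldDx`-derivative and F_{u_t u_t}. -/
lemma pd_t_pd_tx_eq_and_fieldDx : J.pd 0 1 (J.pd 1 1 F) = 4 * J.pd 0 1 (J.pd 0 1 F) ∧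
    2 * J.fieldDx (J.pd 0 1 (J.pd 0 1 F)) = 3 * J.pd 0 1 (J.pd 0 1 F) := by
  have h1 := J.pd_fieldDx_t (J.pd 1 1 F)
  have h2 := J.pd_fieldDx_tx (J.pd 1 1 F)
  rw [fieldDx_pd_tx hF hE, pd_tx_pd_tx_eq hF hE] at h1 h2
  have h3 : J.pd 1 1 (J.pd 0 1 F) = J.pd 0 1 (J.pd 1 1 F) := J.pd_comm _ _ _ _ _
  simp [derivation_ofNat, J.pd_u, pd_pd_tt hF hE, pd_pt_pd_tt hF hE, h3] at h1 h2
  have h4 : J.pd 0 1 (J.pd 1 1 F) = 4 * J.pd 0 1 (J.pd 0 1 F) := by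
    linear_combination h2 + 2 * h1
  refine ⟨h4, ?_⟩
  rw [h4] at h1
  simp [derivation_ofNat] at h1
  have := eq_zero_of_ofNat_mul (n := 2) (y := 2 * J.fieldDx (J.pd 0 1 (J.pd 0 1 F))
    - 3 * J.pd 0 1 (J.pd 0 1 F)) (by linear_combination -h1)
  linear_combination this

end TimeDerivatives

end JetCalculus

/-! ### Linearity in u_t and u_tx, and vanishing of the u_tt-derivative. -/

namespace JetCalculus

variable {R : Type*} [CommRing R] [Algebra ℝ R] {J : JetCalculus R} {F : R}

section TimeDerivatives

variable (hF : J.LowOrder F) (hE : J.eulerMul F = 0)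
include hF hE

lemma pd_pd_t_pd_t_and_px :
    (∀ i j, J.pd i j (J.pd 0 1 (J.pd 0 1 F)) = 0) ∧
      2 * J.px (J.pd 0 1 (J.pd 0 1 F)) = 3 * J.pd 0 1 (J.pd 0 1 F) := by
  obtain ⟨hb, hx⟩ := pd_t_pd_tx_eq_and_fieldDx hF hE
  have hb' := pd_tx_pd_tx_eq hF hE
  have hc : J.pd 1 1 (J.pd 0 1 F) = 4 * J.pd 0 1 (J.pd 0 1 F) := by rw [J.pd_comm, hb]
  have h1 := congrArg (J.pd 0 1) (fieldXX_pd_t hF hE)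
  have h2 := congrArg (J.pd 0 1) (fieldX_pd_t hF hE)
  have h3 := congrArg (J.pd 0 1) (fieldU_pd_tx hF hE)
  have h4 := congrArg (J.pd 0 1) hc
  have h5 := congrArg (J.pd 1 1) hb
  have h7 : J.pd 0 2 (J.pd 0 1 (J.pd 0 1 F)) = 0 := by
    rw [J.pd_comm, J.pd_comm 0 2, pd_pd_tt hF hE, map_zero]
  rw [pd_fieldXX, map_zero] at h1
  rw [pd_fieldX] at h2
  rw [pd_fieldU, hb] at h3
  rw [J.pd_comm 1 1, hb'] at h5
  rw [J.pd_comm 0 1 1 1] at h4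
  simp [derivation_ofNat, pd_pd_tt hF hE, hb] at h2 h3 h4 h5
  have hlow := (hF.pd 0 1).pd 0 1
  clear hb hb' hc
  generalize J.pd 0 1 (J.pd 0 1 F) = e at *
  -- With e = F_{u_t u_t} and q = ∂_{u_t}e, `h4` says ∂_{u_tx}e = 4q while `h5` says 4∂_{u_tx}e =
  -- −8q.
  have hq : J.pd 0 1 e = 0 :=
    eq_zero_of_ofNat_mul (n := 24) (by linear_combination -h5 - 4 * h4)
  have hs : J.pd 1 1 e = 0 := by rw [h4, hq, mul_zero]
  replace h3 := eq_zero_of_ofNat_mul h3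
  simp [fieldXX, fieldX, fieldU, hq, hs] at h1 h2 h3
  refine ⟨fun i j => ?_, ?_⟩
  · by_cases h : 3 ≤ i + j
    · exact hlow i j h
    · have : i ≤ 2 := by omega
      have : j ≤ 2 := by omega
      interval_cases i <;> interval_cases j <;> first | assumption | omega
  · simpa [fieldDx, hq, hs, h2, h3] using hx

/-- The u_tt-coefficient of the Euler identity. Its derivative in u_t gives F_{u_t u_t} = 0, its
derivative in u_x gives F_{u_tt} = 0, and what is left of it is `px_px_pd_t`. -/
lemma pd_tt_euler :
    J.Dx (J.Dx (J.pd 0 1 F)) - 2 * J.pd 0 1 F + J.pt (J.pd 0 2 F)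
      - J.novikov * J.pd 0 1 (J.pd 0 1 F) + J.Dx (J.novikov * J.pd 0 1 (J.pd 1 1 F))
      + J.Dx (J.pd 1 1 F) + (4 * J.u 3 0 - 16 * J.u 1 0) * J.pd 0 2 F = 0 := by
  have h := congrArg (J.pd 0 2) hE
  simp [J.eulerMul_eq hF, derivation_ofNat, J.pd_novikov, J.pd_Dx, J.pd_Dt, J.Dx_u, J.Dt_u, J.pd_u,
    hF _ _, (hF.pd _ _) _ _, ((hF.pd _ _).pd _ _) _ _, J.pd_sort, pd_pd_tt hF hE, Dx_pd_tt hF hE,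
    Dt_pd_tt hF hE, pd_pt_pd_tt hF hE, Dx_pt_pd_tt hF hE] at h
  simp
  linear_combination h

lemma pd_t_pd_t_eq_zero : J.pd 0 1 (J.pd 0 1 F) = 0 := by
  obtain ⟨hb, hx⟩ := pd_t_pd_tx_eq_and_fieldDx hF hE
  obtain ⟨he, hx⟩ := pd_pd_t_pd_t_and_px hF hE
  have h := congrArg (J.pd 0 1) (pd_tt_euler hF hE)
  have hlow := (hF.pd 0 1).pd 0 1
  rw [hb] at h
  simp [derivation_ofNat, J.pd_novikov, J.pd_Dx, J.pd_u, J.pd_sort, pd_pd_tt hF hE, he, hb,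
    pd_pt_pd_tt hF hE] at h
  generalize J.pd 0 1 (J.pd 0 1 F) = e at *
  have h1 : J.Dx e = J.px e := by simp [J.Dx_eq _ hlow, he]
  have h2 : J.Dx (J.px e) = J.px (J.px e) := by simp [J.Dx_eq _ hlow.px, ← J.px_pd, he]
  have h3 := congrArg J.px hx
  simp [derivation_ofNat, J.px_u, h1, h2] at h h3
  -- `h` reads e_xx + 8e_x = 3e, whereas 2e_x = 3e makes the difference of the two sides (9/4 + 12 −
  -- 3)e = (45/4)e.
  refine eq_zero_of_ofNat_mul (n := 45) ?_
  linear_combination 4 * h - 2 * h3 - 19 * hx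

lemma pd_tt_eq_zero : J.pd 0 2 F = 0 := by
  obtain ⟨hb, -⟩ := pd_t_pd_tx_eq_and_fieldDx hF hE
  have hb' := pd_tx_pd_tx_eq hF hE
  have he := pd_t_pd_t_eq_zero hF hE
  rw [he, mul_zero] at hb
  rw [hb, mul_zero] at hb'
  have hc : J.pd 1 1 (J.pd 0 1 F) = 0 := by rw [J.pd_comm, hb]
  have h1 := fieldX_pd_t hF hE
  have h2 := fieldX_pd_tx hF hE
  have h3 := fieldU_pd_tx hF hE
  have h4 := J.fieldU_fieldDx (J.pd 1 1 F)
  have h := congrArg (J.pd 1 0) (pd_tt_euler hF hE)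
  rw [h3, fieldDx_pd_tx hF hE] at h4
  simp [fieldX, fieldU, fieldDx, derivation_ofNat, J.pd_u, pd_pd_tt hF hE, pd_pt_pd_tt hF hE,
    px_pd_tt hF hE, he, hb, hb', hc] at h1 h2 h3 h4
  simp [derivation_ofNat, J.pd_novikov, J.pd_Dx, J.pd_u, J.pd_sort, pd_pd_tt hF hE, he, hb, h1, h2,
    h3, pd_pt_pd_tt hF hE, Dx_pd_tt hF hE] at h
  have h5 : J.pd 0 0 (J.pd 0 1 F) = 0 := eq_zero_of_ofNat_mul (n := 2) (by linear_combination h4)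
  simp [h5] at h
  -- The u_x-derivative of `pd_tt_euler` collects 8F_{u_tt} from −2F_{u_t}, 4F_{u_tt} from D_x
  -- F_{u_tx}, and −16F_{u_tt} from the last term.
  refine eq_zero_of_ofNat_mul (n := 4) ?_
  linear_combination -h

end TimeDerivatives

end JetCalculus

/-! ### The lower coefficients: u_x, u_xx, u, and the x- and t-dependence. -/

namespace JetCalculus

variable {R : Type*} [CommRing R] [Algebra ℝ R] {J : JetCalculus R} {F : R}

section SpaceDerivatives

variable (hF : J.LowOrder F) (hE : J.eulerMul F = 0)
include hF hE

lemma pd_pd_t_and_pd_pd_tx :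
    (∀ i j, J.pd i j (J.pd 0 1 F) = 0) ∧ (∀ i j, J.pd i j (J.pd 1 1 F) = 0) := by
  obtain ⟨hb, -⟩ := pd_t_pd_tx_eq_and_fieldDx hF hE
  have hb' := pd_tx_pd_tx_eq hF hE
  have he := pd_t_pd_t_eq_zero hF hE
  have hw := pd_tt_eq_zero hF hE
  rw [he, mul_zero] at hb
  rw [hb, mul_zero] at hb'
  have hc : J.pd 1 1 (J.pd 0 1 F) = 0 := by rw [J.pd_comm, hb]
  have h1 := fieldX_pd_t hF hE
  have h2 := fieldX_pd_tx hF hE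
  have h3 := fieldU_pd_tx hF hE
  have h4 := J.fieldU_fieldDx (J.pd 1 1 F)
  have h5 := fieldXX_pd_t hF hE
  have h6 := fieldXX_pd_tx hF hE
  rw [h3, fieldDx_pd_tx hF hE] at h4
  have hc2 : J.pd 0 2 (J.pd 0 1 F) = 0 := by rw [J.pd_comm, hw, map_zero]
  have hb2 : J.pd 0 2 (J.pd 1 1 F) = 0 := by rw [J.pd_comm, hw, map_zero]
  simp [fieldXX, fieldX, fieldU, derivation_ofNat, J.pd_u, he, hb, hb', hc, hw]
    at h1 h2 h3 h4 h5 h6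
  have h7 : J.pd 0 0 (J.pd 0 1 F) = 0 := eq_zero_of_ofNat_mul (n := 2) (by linear_combination h4)
  constructor <;> intro i j
  all_goals
    by_cases h : 3 ≤ i + j
    · exact hF.pd _ _ i j h
    · have : i ≤ 2 := by omega
      have : j ≤ 2 := by omega
      interval_cases i <;> interval_cases j <;> first | assumption | omega

lemma pd_pd_t (i j : ℕ) : J.pd i j (J.pd 0 1 F) = 0 := (pd_pd_t_and_pd_pd_tx hF hE).1 i j

lemma pd_pd_tx (i j : ℕ) : J.pd i j (J.pd 1 1 F) = 0 := (pd_pd_t_and_pd_pd_tx hF hE).2 i j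

lemma px_pd_tx : J.px (J.pd 1 1 F) = -2 * J.pd 0 1 F := by
  have h := fieldDx_pd_tx hF hE
  simpa [fieldDx, pd_pd_tx hF hE, pd_tt_eq_zero hF hE] using h

lemma pd_x_eq : J.pd 1 0 F = -(4 * J.u 0 0 - 2 * J.u 1 0) * J.pd 0 1 F
    - (4 * J.u 1 0 - 2 * J.u 2 0) * J.pd 1 1 F := by
  have h := fieldX_self hF hE
  simp [fieldX, pd_tt_eq_zero hF hE] at h
  linear_combination h

lemma Dx_pd_tx_eq : J.Dx (J.pd 1 1 F) = -2 * J.pd 0 1 F := by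
  simp [J.Dx_eq _ (hF.pd 1 1), pd_pd_tx hF hE, px_pd_tx hF hE]

lemma Dt_pd_tx_eq : J.Dt (J.pd 1 1 F) = J.pt (J.pd 1 1 F) := by
  simp [J.Dt_eq _ (hF.pd 1 1), pd_pd_tx hF hE]

lemma Dx_pd_t_eq : J.Dx (J.pd 0 1 F) = J.px (J.pd 0 1 F) := by
  simp [J.Dx_eq _ (hF.pd 0 1), pd_pd_t hF hE]

lemma Dt_pd_t_eq : J.Dt (J.pd 0 1 F) = J.pt (J.pd 0 1 F) := by
  simp [J.Dt_eq _ (hF.pd 0 1), pd_pd_t hF hE]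

lemma px_px_pd_t : J.px (J.px (J.pd 0 1 F)) = 4 * J.pd 0 1 F := by
  have h := pd_tt_euler hF hE
  have h1 : J.Dx (J.px (J.pd 0 1 F)) = J.px (J.px (J.pd 0 1 F)) := by
    simp [J.Dx_eq _ (hF.pd 0 1).px, ← J.px_pd, pd_pd_t hF hE]
  simp [pd_pd_t hF hE, pd_pd_tx hF hE, pd_tt_eq_zero hF hE, Dx_pd_t_eq hF hE, Dx_pd_tx_eq hF hE,
    h1] at h
  linear_combination h

/-- The earlier relations show that y = `fieldXX F` depends only on x, t, u and u_xx. The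
u_xxxx-coefficient is then a first order equation for y, polynomial in u_x and u_t, which splits
again. -/
lemma fieldXX_self : J.fieldXX F = 0 := by
  obtain ⟨y, hy⟩ : ∃ y, y = J.fieldXX F := ⟨_, rfl⟩
  have hr : J.pd 2 0 F = y - (4 * J.u 0 0 - 2 * J.u 1 0) * J.pd 1 1 F := by
    rw [hy]
    simp [fieldXX]
  have hy1 : J.pd 1 1 y = 0 ∧ J.pd 0 1 y = 0 ∧ J.pd 1 0 y = 0 ∧ J.pd 0 2 y = 0 ∧
      J.LowOrder y := by
    refine ⟨?_, ?_, ?_, ?_, fun i j hij => ?_⟩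
    · simp [hy, fieldXX, derivation_ofNat, J.pd_u, J.pd_sort, pd_pd_tx hF hE]
    · simp [hy, fieldXX, derivation_ofNat, J.pd_u, J.pd_sort, pd_pd_tx hF hE, pd_pd_t hF hE]
    · simp [hy, fieldXX, derivation_ofNat, J.pd_u, J.pd_comm 1 0 2 0, pd_x_eq hF hE,
        pd_pd_tx hF hE, pd_pd_t hF hE]
    · simp [hy, fieldXX, derivation_ofNat, J.pd_u, J.pd_sort, pd_pd_tx hF hE,
        pd_tt_eq_zero hF hE]
    · have h0 := J.pd_u i j 0 0 (by norm_num)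
      have h1 := J.pd_u i j 1 0 (by norm_num)
      rw [if_neg (by omega)] at h0 h1
      simp [hy, fieldXX, derivation_ofNat, h0, h1, hF.pd _ _ i j hij, (hF.pd _ _).pd _ _ i j hij]
  obtain ⟨hs, hq, hp, hw, hlow⟩ := hy1
  have h := congrArg (J.pd 4 0) hE
  simp [J.eulerMul_eq hF, derivation_ofNat, J.pd_novikov, J.pd_Dx, J.pd_Dt, J.Dx_u, J.Dt_u, J.pd_u,
    hF _ _, (hF.pd _ _) _ _, ((hF.pd _ _).pd _ _) _ _, J.pd_sort, pd_pd_tx hF hE, pd_pd_t hF hE,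
    pd_tt_eq_zero hF hE, hr, pd_x_eq hF hE, Dx_pd_tx_eq hF hE, hlow 4 0] at h
  simp only [hlow 3 0 (by norm_num), map_zero, mul_zero] at h
  -- The u_xxx-terms of D_t y + … cancel once u_txx is eliminated through the equation. The
  -- u_x²-part then gives y_u = 0, the u_t-part y_{u_xx} = 0, and the u_xx-derivative finally −6y =
  -- 0.
  have h1 : J.pt y + J.u 0 1 * J.pd 0 0 y + 3 * (4 * J.u 1 0 - 2 * J.u 2 0) * y
      - (4 * J.u 0 0 - 2 * J.u 1 0) * (J.px y + J.u 1 0 * J.pd 0 0 y)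
      + (J.u 0 1 - 16 * J.u 0 0 * J.u 1 0 + 8 * J.u 1 0 * J.u 2 0 - 2 * J.u 2 0 * J.u 2 0)
        * J.pd 2 0 y = 0 := by
    rw [J.Dx_eq y hlow, J.Dt_eq y hlow, hs, hq, hp, hw, novikov] at h
    linear_combination h
  have hrp : J.pd 1 0 (J.pd 2 0 y) = 0 := by rw [J.pd_comm, hp, map_zero]
  have h2 := congrArg (J.pd 0 1) h1
  have h3 := congrArg (J.pd 1 0) (congrArg (J.pd 1 0) h1)
  simp [derivation_ofNat, J.pd_u, ← J.px_pd, ← J.pt_pd, J.pd_sort, hs, hq, hp, hw, hrp] at h2 h3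
  have h4 : J.pd 0 0 y = 0 := eq_zero_of_ofNat_mul (n := 4) (by linear_combination h3)
  have h5 : J.pd 2 0 y = 0 := by linear_combination h2 - h4
  have h6 := congrArg (J.pd 2 0) h1
  simp [derivation_ofNat, J.pd_u, ← J.px_pd, ← J.pt_pd, J.pd_sort, hs, hq, hp, hw, h4, h5] at h6
  rw [← hy]
  refine eq_zero_of_ofNat_mul (n := 6) ?_
  linear_combination h6

lemma pd_xx_eq : J.pd 2 0 F = -(4 * J.u 0 0 - 2 * J.u 1 0) * J.pd 1 1 F := by
  have h := fieldXX_self hF hE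
  simp [fieldXX] at h
  linear_combination h

lemma Dx_pt_pd_tx : J.Dx (J.pt (J.pd 1 1 F)) = -2 * J.pt (J.pd 0 1 F) := by
  simp [J.Dx_eq _ (hF.pd 1 1).pt, ← J.pt_pd, pd_pd_tx hF hE, ← J.pt_px, px_pd_tx hF hE,
    derivation_ofNat]

lemma Dx_pt_pd_t : J.Dx (J.pt (J.pd 0 1 F)) = J.px (J.pt (J.pd 0 1 F)) := by
  simp [J.Dx_eq _ (hF.pd 0 1).pt, ← J.pt_pd, pd_pd_t hF hE]

lemma Dx_px_pd_t : J.Dx (J.px (J.pd 0 1 F)) = 4 * J.pd 0 1 F := by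
  simp [J.Dx_eq _ (hF.pd 0 1).px, ← J.px_pd, pd_pd_t hF hE, px_px_pd_t hF hE]

/-- The u_tx-coefficient. Its u_x-derivative determines F_{uu}, and its u-derivative then yields
`px_pd_t`. -/
lemma Dx_pd_u : J.Dx (J.pd 0 0 F) = (16 * J.u 1 0 - 4 * J.u 3 0) * J.pd 1 1 F
    + (4 * J.u 2 0 - 2 * J.u 1 0 - 12 * J.u 0 0) * J.pd 0 1 F := by
  have h := congrArg (J.pd 1 1) hE
  simp [J.eulerMul_eq hF, derivation_ofNat, J.pd_novikov, J.pd_Dx, J.pd_Dt, J.Dx_u, J.Dt_u, J.pd_u,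
    hF _ _, (hF.pd _ _) _ _, ((hF.pd _ _).pd _ _) _ _, J.pd_sort, ← J.px_pd, ← J.pt_pd,
    pd_pd_tx hF hE, pd_pd_t hF hE, pd_tt_eq_zero hF hE, pd_xx_eq hF hE, pd_x_eq hF hE,
    Dx_pd_tx_eq hF hE, Dx_pd_t_eq hF hE, Dt_pd_tx_eq hF hE, Dt_pd_t_eq hF hE, Dx_pt_pd_tx hF hE,
    Dx_pt_pd_t hF hE, Dx_px_pd_t hF hE] at h
  rw [← sub_eq_zero]
  refine eq_zero_of_ofNat_mul (n := 2) ?_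
  linear_combination h

lemma pd_u_pd_u : J.pd 0 0 (J.pd 0 0 F) =
    16 * J.pd 1 1 F - 2 * J.pd 0 1 F + 4 * J.px (J.pd 0 1 F) := by
  have h := congrArg (J.pd 1 0) (Dx_pd_u hF hE)
  simp [J.pd_Dx, derivation_ofNat, J.pd_u, J.pd_sort, pd_pd_tx hF hE, pd_pd_t hF hE, pd_x_eq hF hE,
    Dx_pd_t_eq hF hE] at h
  linear_combination h

lemma px_pd_t : J.px (J.pd 0 1 F) = -2 * J.pd 0 1 F := by
  have h := congrArg (J.pd 0 0) (Dx_pd_u hF hE)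
  simp [J.pd_Dx, derivation_ofNat, J.pd_u, pd_pd_tx hF hE, pd_pd_t hF hE, pd_u_pd_u hF hE,
    Dx_pd_t_eq hF hE, Dx_pd_tx_eq hF hE, Dx_px_pd_t hF hE] at h
  rw [← sub_eq_zero]
  refine eq_zero_of_ofNat_mul (n := 2) ?_
  linear_combination -h

/-- The mixed coefficient of u·u_xx is a linear relation between ∂_t F_{u_t} and ∂_t F_{u_tx}.
Differentiating in x turns both into multiples of ∂_t F_{u_t}, so a second, independent relation
results. -/
lemma pt_pd_t_and_pt_pd_tx : J.pt (J.pd 0 1 F) = 0 ∧ J.pt (J.pd 1 1 F) = 0 := by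
  have h := congrArg (J.pd 0 0) (congrArg (J.pd 2 0) hE)
  simp [J.eulerMul_eq hF, derivation_ofNat, J.pd_novikov, J.pd_Dx, J.pd_Dt, J.Dx_u, J.Dt_u, J.pd_u,
    hF _ _, (hF.pd _ _) _ _, ((hF.pd _ _).pd _ _) _ _, J.pd_sort, ← J.px_pd, ← J.pt_pd,
    pd_pd_tx hF hE, pd_pd_t hF hE, pd_tt_eq_zero hF hE, pd_xx_eq hF hE, pd_x_eq hF hE,
    Dx_pd_tx_eq hF hE, Dx_pd_t_eq hF hE, Dt_pd_tx_eq hF hE, Dt_pd_t_eq hF hE, Dx_pt_pd_tx hF hE,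
    Dx_pt_pd_t hF hE, Dx_px_pd_t hF hE, Dx_pd_u hF hE, pd_u_pd_u hF hE, px_pd_t hF hE] at h
  have h1 := congrArg J.px h
  simp [J.px_u, derivation_ofNat, ← J.pt_px, px_pd_t hF hE, px_pd_tx hF hE] at h1
  have h2 : J.pt (J.pd 0 1 F) = 0 := eq_zero_of_ofNat_mul (n := 12) (by linear_combination h1)
  refine ⟨h2, ?_⟩
  simp [h2] at h
  exact eq_zero_of_ofNat_mul (n := 4) (by linear_combination h)

end SpaceDerivatives

end JetCalculus

/-! ### Solution of the determining equations. -/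

namespace JetCalculus

variable {R : Type*} [CommRing R] [Algebra ℝ R] {J : JetCalculus R} {F : R}

lemma LowOrder.sub {f g : R} (hf : J.LowOrder f) (hg : J.LowOrder g) : J.LowOrder (f - g) :=
  fun i j hij => by rw [map_sub, hf i j hij, hg i j hij, sub_zero]

lemma LowOrder.mul {f g : R} (hf : J.LowOrder f) (hg : J.LowOrder g) : J.LowOrder (f * g) :=
  fun i j hij => by simp [hf i j hij, hg i j hij]

lemma LowOrder.smul {f : R} (hf : J.LowOrder f) (c : ℝ) : J.LowOrder (c • f) :=
  fun i j hij => by rw [Derivation.map_smul, hf i j hij, smul_zero]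

lemma lowOrder_u {k l : ℕ} (h : k + l ≤ 2) : J.LowOrder (J.u k l) :=
  fun i j hij => by rw [J.pd_u i j k l (by omega), if_neg (by omega)]

lemma eulerMul_sub (f g : R) : J.eulerMul (f - g) = J.eulerMul f - J.eulerMul g := by
  simp only [eulerMul, sub_mul, map_sub]
  ring

lemma eulerMul_smul (c : ℝ) (f : R) : J.eulerMul (c • f) = c • J.eulerMul f := by
  simp only [eulerMul, smul_mul_assoc, Derivation.map_smul, smul_add, smul_sub]

/-- All partial derivatives of `f` vanish. -/
def IsConstant (J : JetCalculus R) (f : R) : Prop :=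
  (∀ i j, J.pd i j f = 0) ∧ J.px f = 0 ∧ J.pt f = 0

section PointSymmetric

variable (hF : J.LowOrder F) (hE : J.eulerMul F = 0) (hq : J.pd 0 1 F = 0) (hs : J.pd 1 1 F = 0)
include hF hE hq hs

lemma pd_pd_u_of_pd_t_eq_zero (i j : ℕ) : J.pd i j (J.pd 0 0 F) = 0 := by
  by_cases h : 3 ≤ i + j
  · exact hF.pd _ _ i j h
  · have : i ≤ 2 := by omega
    have : j ≤ 2 := by omega
    interval_cases i <;> interval_cases j <;>
      first
      | omega
      | simp [J.pd_sort, hq, hs, pd_tt_eq_zero hF hE, pd_x_eq hF hE, pd_xx_eq hF hE,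
          pd_u_pd_u hF hE]

lemma px_pd_u_of_pd_t_eq_zero : J.px (J.pd 0 0 F) = 0 := by
  have h := Dx_pd_u hF hE
  simpa [J.Dx_eq _ (hF.pd 0 0), hq, hs, pd_pd_u_of_pd_t_eq_zero hF hE hq hs] using h

/-- Here F is v(t)u + f(x,t) up to integration. The u_xx- and u-coefficients read v_t − 4f_x + 2f_xx
= 0 and −v_t + 16f_x − 4f_xxx = 0, whence f_xx = 2f_x and v_t = 0. The remainder f_txx = f_t and its
x-derivative give f_tx = 0, then f_t = 0. -/
lemma derivatives_of_pd_t_eq_zero :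
    J.px (J.px F) = 2 * J.px F ∧ J.pt (J.pd 0 0 F) = 0 ∧ J.pt F = 0 := by
  have hv := pd_pd_u_of_pd_t_eq_zero hF hE hq hs
  have hvx := px_pd_u_of_pd_t_eq_zero hF hE hq hs
  have hw := pd_tt_eq_zero hF hE
  have hp : J.pd 1 0 F = 0 := by simp [pd_x_eq hF hE, hq, hs]
  have hr : J.pd 2 0 F = 0 := by simp [pd_xx_eq hF hE, hs]
  have hDv : J.Dx (J.pd 0 0 F) = 0 := by simp [J.Dx_eq _ (hF.pd 0 0), hv, hvx]
  have h1 : J.Dx F = J.px F + J.u 1 0 * J.pd 0 0 F := by simp [J.Dx_eq _ hF, hq, hs, hw, hp, hr]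
  have h2 : J.Dt F = J.pt F + J.u 0 1 * J.pd 0 0 F := by simp [J.Dt_eq _ hF, hq, hs, hw, hp, hr]
  have h3 : J.Dx (J.px F) = J.px (J.px F) := by
    simp [J.Dx_eq _ hF.px, ← J.px_pd, hq, hs, hw, hp, hr, hvx]
  have h4 : J.Dx (J.px (J.px F)) = J.px (J.px (J.px F)) := by
    simp [J.Dx_eq _ hF.px.px, ← J.px_pd, hq, hs, hw, hp, hr, hvx]
  have h5 : J.Dx (J.pt F) = J.px (J.pt F) + J.u 1 0 * J.pt (J.pd 0 0 F) := by
    simp [J.Dx_eq _ hF.pt, ← J.pt_pd, hq, hs, hw, hp, hr]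
  have h6 : J.Dx (J.pt (J.pd 0 0 F)) = 0 := by
    simp [J.Dx_eq _ (hF.pd 0 0).pt, ← J.pt_pd, hv, ← J.pt_px, hvx]
  have hvtx : J.px (J.pt (J.pd 0 0 F)) = 0 := by rw [← J.pt_px, hvx, map_zero]
  have h7 : J.Dx (J.px (J.pt F)) = J.px (J.px (J.pt F)) := by
    simp [J.Dx_eq _ hF.pt.px, ← J.px_pd, ← J.pt_pd, hq, hs, hw, hp, hr, hvtx]
  have h := hE
  simp [J.eulerMul_eq hF, derivation_ofNat, hq, hs, hw, hp, hr, h1, h2, h3, h4, h5, h6, h7, hDv,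
    J.Dx_u, novikov] at h
  have hr' := congrArg (J.pd 2 0) h
  have hu' := congrArg (J.pd 0 0) h
  simp [derivation_ofNat, J.pd_u, ← J.px_pd, ← J.pt_pd, hq, hs, hw, hp, hr, hv, hvx, hvtx]
    at hr' hu'
  have hrx := congrArg J.px hr'
  simp [derivation_ofNat, J.px_u, hvx, hvtx] at hrx
  have hxx : J.px (J.px F) = 2 * J.px F := by
    have := eq_zero_of_ofNat_mul (n := 6) (y := J.px (J.px F) - 2 * J.px F)
      (by linear_combination -2 * hrx - hr' - hu')
    linear_combination this
  have hxxx : J.px (J.px (J.px F)) = 4 * J.px F := by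
    rw [hxx]
    simp [derivation_ofNat, hxx]
    ring
  have hut : J.pt (J.pd 0 0 F) = 0 := by
    rw [hxxx] at hu'
    linear_combination -hu'
  refine ⟨hxx, hut, ?_⟩
  have h8 : J.px (J.px (J.pt F)) = 2 * J.px (J.pt F) := by
    rw [← J.pt_px, ← J.pt_px, hxx]
    simp [derivation_ofNat]
  rw [hxxx, hxx, hut, h8] at h
  have h9 := congrArg J.px h
  simp [derivation_ofNat, J.px_u, hvx, hxx, h8] at h h9
  have h10 : J.px (J.pt F) = 0 := eq_zero_of_ofNat_mul (n := 3) (by linear_combination h9)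
  rw [h10] at h
  linear_combination -h

end PointSymmetric

/-- The fourth listed characteristic. -/
def phi₄ (J : JetCalculus R) : R :=
  -(4 * (J.u 0 0 * J.u 0 0)) + J.u 1 0 * J.u 1 0 + 2 * (J.u 0 0 * J.u 2 0) - J.u 1 0 * J.u 2 0
    - (1 / 2 : ℝ) • J.u 1 1

/-- The polynomial factor of the fifth listed characteristic. -/
def phi₅ (J : JetCalculus R) : R :=
  3 * (J.u 0 0 * J.u 0 0) - 4 * (J.u 0 0 * J.u 1 0) - J.u 1 0 * J.u 1 0 + J.u 0 1
    - 4 * (J.u 0 0 * J.u 2 0) + 2 * (J.u 1 0 * J.u 2 0) + J.u 1 1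

theorem exists_linear_combination (hF : J.LowOrder F) (hE : J.eulerMul F = 0)
    (hconst : ∀ f, J.IsConstant f → ∃ c : ℝ, f = algebraMap ℝ R c)
    {X Y : R} (hXY : X * Y = 1) (hX : ∀ i j, J.pd i j X = 0) (hXx : J.px X = 2 * X)
    (hXt : J.pt X = 0) (hY : ∀ i j, J.pd i j Y = 0) (hYx : J.px Y = -2 * Y) (hYt : J.pt Y = 0)
    (h₄ : J.eulerMul J.phi₄ = 0) (h₅ : J.eulerMul (Y * J.phi₅) = 0) :
    ∃ c₁ c₂ c₃ c₄ c₅ : ℝ, F = c₁ • 1 + c₂ • X + c₃ • J.u 0 0 + c₄ • J.phi₄ + c₅ • (Y * J.phi₅) := by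
  obtain ⟨hqt, hst⟩ := pt_pd_t_and_pt_pd_tx hF hE
  -- φ₅ has equal derivatives e^{−2x} in u_t and u_tx, while φ₄ has 0 and −1/2. So 2(F_{u_t} −
  -- F_{u_tx}) isolates the coefficient of φ₄, and e^{2x}F_{u_t} that of φ₅.
  obtain ⟨c₄, hc₄⟩ := hconst (2 * (J.pd 0 1 F - J.pd 1 1 F)) (by
    refine ⟨fun i j => ?_, ?_, ?_⟩ <;>
      simp [derivation_ofNat, pd_pd_t hF hE, pd_pd_tx hF hE, px_pd_t hF hE, px_pd_tx hF hE, hqt,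
        hst])
  obtain ⟨c₅, hc₅⟩ := hconst (X * J.pd 0 1 F) (by
    refine ⟨fun i j => ?_, ?_, ?_⟩
    · simp [pd_pd_t hF hE, hX]
    · simp [px_pd_t hF hE, hXx]
      ring
    · simp [hqt, hXt])
  have hYlow : J.LowOrder Y := fun i j _ => hY i j
  have h₄low : J.LowOrder J.phi₄ := by
    intro i j hij
    have hl := fun k l (h : k + l ≤ 2) => lowOrder_u (J := J) h i j hij
    simp [phi₄, derivation_ofNat, hl]
  have h₅low : J.LowOrder J.phi₅ := by
    intro i j hij
    have hl := fun k l (h : k + l ≤ 2) => lowOrder_u (J := J) h i j hij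
    simp [phi₅, derivation_ofNat, hl]
  obtain ⟨G, hG⟩ : ∃ G, G = F - c₄ • J.phi₄ - c₅ • (Y * J.phi₅) := ⟨_, rfl⟩
  have hGlow : J.LowOrder G := by
    rw [hG]
    exact (hF.sub (h₄low.smul _)).sub ((hYlow.mul h₅low).smul _)
  have hGE : J.eulerMul G = 0 := by
    simp [hG, eulerMul_sub, eulerMul_smul, hE, h₄, h₅]
  have hGq : J.pd 0 1 G = 0 := by
    simp [hG, phi₄, phi₅, derivation_ofNat, J.pd_u, hY, Algebra.smul_def]
    linear_combination -J.pd 0 1 F * hXY + Y * hc₅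
  have hhalf : (2 : R) * algebraMap ℝ R (1 / 2) = 1 := by
    rw [← map_ofNat (algebraMap ℝ R) 2, ← map_mul]
    norm_num
  have hGs : J.pd 1 1 G = 0 := by
    simp only [one_div] at hhalf
    simp [hG, phi₄, phi₅, derivation_ofNat, J.pd_u, hY, Algebra.smul_def]
    linear_combination -J.pd 0 1 F * hXY + Y * hc₅ + (J.pd 0 1 F - J.pd 1 1 F) * hhalf
      - algebraMap ℝ R 2⁻¹ * hc₄
  have hv := pd_pd_u_of_pd_t_eq_zero hGlow hGE hGq hGs
  have hvx := px_pd_u_of_pd_t_eq_zero hGlow hGE hGq hGs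
  obtain ⟨hxx, hvt, ht⟩ := derivatives_of_pd_t_eq_zero hGlow hGE hGq hGs
  have hGw := pd_tt_eq_zero hGlow hGE
  have hGp : J.pd 1 0 G = 0 := by simp [pd_x_eq hGlow hGE, hGq, hGs]
  have hGr : J.pd 2 0 G = 0 := by simp [pd_xx_eq hGlow hGE, hGs]
  have hpd : ∀ i j, ¬(i = 0 ∧ j = 0) → J.pd i j G = 0 := by
    intro i j h0
    by_cases h : 3 ≤ i + j
    · exact hGlow i j h
    · have : i ≤ 2 := by omega
      have : j ≤ 2 := by omega
      interval_cases i <;> interval_cases j <;> first | assumption | omega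
  have hpx : ∀ i j, J.pd i j (J.px G) = 0 := by
    intro i j
    rw [← J.px_pd]
    by_cases h0 : i = 0 ∧ j = 0
    · rw [h0.1, h0.2, hvx]
    · rw [hpd i j h0, map_zero]
  obtain ⟨c₃, hc₃⟩ := hconst (J.pd 0 0 G) ⟨hv, hvx, hvt⟩
  obtain ⟨c₂, hc₂⟩ := hconst (Y * J.px G) (by
    refine ⟨fun i j => ?_, ?_, ?_⟩
    · simp [hpx, hY]
    · simp [hYx, hxx]
      ring
    · simp [hYt, J.pt_px, ht])
  obtain ⟨c₁, hc₁⟩ := hconst (G - (c₂ / 2) • X - c₃ • J.u 0 0) (by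
    have hc₂' : J.px G = c₂ • X := by
      rw [Algebra.smul_def, ← hc₂]
      linear_combination -J.px G * hXY
    refine ⟨fun i j => ?_, ?_, ?_⟩
    · by_cases h0 : i = 0 ∧ j = 0
      · simp [h0.1, h0.2, hX, J.pd_u, hc₃, Algebra.smul_def]
      · have h0' : ¬(j = 0 ∧ i = 0) := by tauto
        simp [hpd i j h0, hX, J.pd_u, h0]
    · have : (c₂ / 2) • (2 * X) = c₂ • X := by
        rw [two_mul, ← two_smul ℝ X, smul_smul, div_mul_cancel₀ _ two_ne_zero]
      simp [hXx, J.px_u, hc₂', this]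
    · simp [hXt, J.pt_u, ht])
  refine ⟨c₁, c₂ / 2, c₃, c₄, c₅, ?_⟩
  rw [← Algebra.algebraMap_eq_smul_one, ← hc₁, hG]
  abel

end JetCalculus

/-! ### The algebra of smooth functions on an open set, with its directional derivatives. -/

section SmoothFunctions

open Classical in
/-- Extension of a function on `Ω` by zero. -/
def extendZero {E : Type*} {Ω : Set E} (f : Ω → ℝ) (z : E) : ℝ := if h : z ∈ Ω then f ⟨z, h⟩ else 0

lemma extendZero_of_mem {E : Type*} {Ω : Set E} (f : Ω → ℝ) {z : E} (h : z ∈ Ω) :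
    extendZero f z = f ⟨z, h⟩ := dif_pos h

variable {E : Type*} [NormedAddCommGroup E] [NormedSpace ℝ E]

/-- The algebra of smooth functions on an open set. -/
def smoothFunctions (Ω : TopologicalSpace.Opens E) : Subalgebra ℝ (Ω → ℝ) where
  carrier := {f | ContDiffOn ℝ ∞ (extendZero (Ω := (Ω : Set E)) f) Ω}
  mul_mem' {f g} hf hg :=
    (ContDiffOn.mul hf hg).congr fun z hz => by
      simp only [extendZero_of_mem _ hz, Pi.mul_apply]
  add_mem' {f g} hf hg :=
    (ContDiffOn.add hf hg).congr fun z hz => by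
      simp only [extendZero_of_mem _ hz, Pi.add_apply]
  algebraMap_mem' c :=
    (contDiffOn_const (c := c)).congr fun z hz => by
      simp only [extendZero_of_mem _ hz]
      rfl

variable {Ω : TopologicalSpace.Opens E}

/-- The restriction to `Ω` of a function which is smooth on `Ω`. -/
def smoothRestrict (g : E → ℝ) (hg : ContDiffOn ℝ ∞ g Ω) : smoothFunctions Ω :=
  ⟨fun z => g z, hg.congr fun z hz => by rw [extendZero_of_mem _ hz]⟩

lemma smoothRestrict_apply (g : E → ℝ) (hg : ContDiffOn ℝ ∞ g Ω) (z : Ω) :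
    (smoothRestrict g hg : Ω → ℝ) z = g z := rfl

lemma contDiffOn_extendZero (f : smoothFunctions Ω) :
    ContDiffOn ℝ ∞ (extendZero (Ω := (Ω : Set E)) (f : Ω → ℝ)) Ω := f.2

lemma contDiffAt_extendZero (f : smoothFunctions Ω) {z : E} (hz : z ∈ Ω) :
    ContDiffAt ℝ ∞ (extendZero (Ω := (Ω : Set E)) (f : Ω → ℝ)) z :=
  (contDiffOn_extendZero f).contDiffAt (Ω.isOpen.mem_nhds hz)

lemma differentiableAt_extendZero (f : smoothFunctions Ω) {z : E} (hz : z ∈ Ω) :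
    DifferentiableAt ℝ (extendZero (Ω := (Ω : Set E)) (f : Ω → ℝ)) z :=
  (contDiffAt_extendZero f hz).differentiableAt (by simp)

/-- Ω is open, so derivatives at its points do not see the extension by zero. -/
lemma extendZero_eventuallyEq {f : Ω → ℝ} {g : E → ℝ} (h : ∀ z : Ω, f z = g z) {z : E}
    (hz : z ∈ Ω) : extendZero (Ω := (Ω : Set E)) f =ᶠ[nhds z] g := by
  filter_upwards [Ω.isOpen.mem_nhds hz] with y hy
  rw [extendZero_of_mem f hy, h]

/-- The derivative of a function on `Ω` in the direction `v`. -/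
def directional (v : E) : Derivation ℝ (smoothFunctions Ω) (smoothFunctions Ω) :=
  Derivation.mk'
    { toFun := fun f => smoothRestrict
        (fun z => fderiv ℝ (extendZero (Ω := (Ω : Set E)) (f : Ω → ℝ)) z v)
        (((contDiffOn_extendZero f).fderiv_of_isOpen Ω.isOpen (m := ∞) (by simp)).clm_apply
          contDiffOn_const)
      map_add' := fun f g => by
        ext z
        simp only [smoothRestrict_apply, Subalgebra.coe_add, Pi.add_apply]
        rw [(extendZero_eventuallyEq (g := extendZero (Ω := (Ω : Set E)) (f : Ω → ℝ)
          + extendZero (Ω := (Ω : Set E)) (g : Ω → ℝ)) (fun y => by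
            simp [extendZero_of_mem _ y.2]) z.2).fderiv_eq,
          fderiv_add (differentiableAt_extendZero f z.2) (differentiableAt_extendZero g z.2)]
        rfl
      map_smul' := fun c f => by
        ext z
        simp only [smoothRestrict_apply, RingHom.id_apply, Subalgebra.coe_smul, Pi.smul_apply]
        rw [(extendZero_eventuallyEq (g := c • extendZero (Ω := (Ω : Set E)) (f : Ω → ℝ))
          (fun y => by simp [extendZero_of_mem _ y.2]) z.2).fderiv_eq,
          fderiv_const_smul (differentiableAt_extendZero f z.2)]
        rfl }
    (fun f g => by
      ext z
      simp only [LinearMap.coe_mk, AddHom.coe_mk, smoothRestrict_apply, Subalgebra.coe_add,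
        Pi.add_apply, smul_eq_mul, Subalgebra.coe_mul, Pi.mul_apply]
      rw [(extendZero_eventuallyEq (g := extendZero (Ω := (Ω : Set E)) (f : Ω → ℝ)
          * extendZero (Ω := (Ω : Set E)) (g : Ω → ℝ)) (fun y => by
            simp [extendZero_of_mem _ y.2]) z.2).fderiv_eq,
          fderiv_mul (differentiableAt_extendZero f z.2) (differentiableAt_extendZero g z.2)]
      simp [extendZero_of_mem _ z.2])

lemma directional_apply (v : E) (f : smoothFunctions Ω) (z : Ω) :
    (directional v f : Ω → ℝ) z =
      fderiv ℝ (extendZero (Ω := (Ω : Set E)) (f : Ω → ℝ)) z v := rfl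

lemma directional_smoothRestrict (v : E) (g : E → ℝ) (hg : ContDiffOn ℝ ∞ g Ω) (z : Ω) :
    (directional v (smoothRestrict g hg) : Ω → ℝ) z = fderiv ℝ g z v := by
  rw [directional_apply,
    (extendZero_eventuallyEq (fun y => smoothRestrict_apply g hg y) z.2).fderiv_eq]

lemma directional_comm (v w : E) (f : smoothFunctions Ω) :
    directional v (directional w f) = directional w (directional v f) := by
  ext z
  have key : ∀ v w : E, (directional v (directional w f) : Ω → ℝ) z =
      fderiv ℝ (fderiv ℝ (extendZero (Ω := (Ω : Set E)) (f : Ω → ℝ))) z v w := by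
    intro v w
    rw [directional_apply,
      (extendZero_eventuallyEq (g := fun y => fderiv ℝ (extendZero (Ω := (Ω : Set E)) (f : Ω → ℝ)) y w)
        (fun y => directional_apply w f y) z.2).fderiv_eq]
    have hd : DifferentiableAt ℝ (fderiv ℝ (extendZero (Ω := (Ω : Set E)) (f : Ω → ℝ))) z :=
      ((contDiffAt_extendZero f z.2).fderiv_right (m := 1) (by norm_cast)).differentiableAt (by simp)
    rw [fderiv_clm_apply hd (differentiableAt_const w)]
    simp
  rw [key, key]
  exact ((contDiffAt_extendZero f z.2).isSymmSndFDerivAt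
    (by rw [minSmoothness_of_isRCLikeNormedField]; exact WithTop.coe_le_coe.mpr le_top)).eq v w

lemma directional_zero (f : smoothFunctions Ω) : directional (0 : E) f = 0 := by
  ext z
  simp [directional_apply]

end SmoothFunctions

/-! ### Truncated total derivatives on a jet space of finite order. -/

section JetSpace

variable {N : ℕ} (Ω : TopologicalSpace.Opens (Jet N))

/-- The jet coordinate `∂_x^i ∂_t^j u`, zero if its order exceeds `N`. -/
def jetCoordCLM (N i j : ℕ) : Jet N →L[ℝ] ℝ :=
  if h : i + j ≤ N then
    (ContinuousLinearMap.proj (R := ℝ) (φ := fun _ : MultiIdx N => ℝ) ⟨(i, j), h⟩).comp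
      ((ContinuousLinearMap.snd ℝ ℝ (MultiIdx N → ℝ)).comp
        (ContinuousLinearMap.snd ℝ ℝ (ℝ × (MultiIdx N → ℝ))))
  else 0

lemma jetCoordCLM_of_le {i j : ℕ} (h : i + j ≤ N) (z : Jet N) :
    jetCoordCLM N i j z = z.2.2 ⟨(i, j), h⟩ := by
  rw [jetCoordCLM, dif_pos h]
  rfl

lemma jetCoordCLM_of_lt {i j : ℕ} (h : N < i + j) (z : Jet N) : jetCoordCLM N i j z = 0 := by
  rw [jetCoordCLM, dif_neg (by omega)]
  rfl

/-- The unit vector in the direction of `∂_x^i ∂_t^j u`, zero if its order exceeds `N`. -/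
def jetVec (N i j : ℕ) : Jet N :=
  if h : i + j ≤ N then (0, 0, Pi.single ⟨(i, j), h⟩ 1) else 0

lemma jetVec_of_lt {i j : ℕ} (h : N < i + j) : jetVec N i j = 0 := by
  rw [jetVec, dif_neg (by omega)]

lemma jetVec_of_le {i j : ℕ} (h : i + j ≤ N) : jetVec N i j = (0, 0, Pi.single ⟨(i, j), h⟩ 1) := by
  rw [jetVec, dif_pos h]

lemma jetCoordCLM_jetVec (i j k l : ℕ) :
    jetCoordCLM N k l (jetVec N i j) = if i = k ∧ j = l ∧ k + l ≤ N then 1 else 0 := by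
  by_cases h : k + l ≤ N
  · rw [jetCoordCLM_of_le h]
    by_cases h' : i + j ≤ N
    · rw [jetVec_of_le h']
      simp only [Pi.single_apply, Subtype.mk.injEq, Prod.mk.injEq]
      congr 1
      simp only [h, and_true, eq_iff_iff]
      omega
    · rw [jetVec_of_lt (by omega), if_neg (by omega)]
      rfl
  · rw [jetCoordCLM_of_lt (by omega), if_neg (by omega)]

/-- A continuous linear functional as a smooth function on `Ω`. -/
def ofCLM (L : Jet N →L[ℝ] ℝ) : smoothFunctions Ω := smoothRestrict L L.contDiff.contDiffOn

lemma directional_ofCLM (L : Jet N →L[ℝ] ℝ) (v : Jet N) :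
    directional v (ofCLM Ω L) = algebraMap ℝ _ (L v) := by
  ext z
  rw [ofCLM, directional_smoothRestrict, L.fderiv]
  rfl

/-- The jet coordinate `∂_x^i ∂_t^j u` as a smooth function on `Ω`. -/
def jetU (i j : ℕ) : smoothFunctions Ω := ofCLM Ω (jetCoordCLM N i j)

/-- The partial derivative with respect to `∂_x^i ∂_t^j u`. -/
def jetPd (i j : ℕ) : Derivation ℝ (smoothFunctions Ω) (smoothFunctions Ω) :=
  directional (jetVec N i j)

/-- The partial derivative with respect to `x`. -/
def jetPx : Derivation ℝ (smoothFunctions Ω) (smoothFunctions Ω) := directional (1, 0, 0)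

/-- The partial derivative with respect to `t`. -/
def jetPt : Derivation ℝ (smoothFunctions Ω) (smoothFunctions Ω) := directional (0, 1, 0)

/-- The total `x`-derivative, with the derivatives of `u` of order greater than `N` set to zero. -/
def jetDx : Derivation ℝ (smoothFunctions Ω) (smoothFunctions Ω) :=
  jetPx Ω + ∑ a : MultiIdx N, jetU Ω (a.1.1 + 1) a.1.2 • jetPd Ω a.1.1 a.1.2

/-- The total `t`-derivative, with the derivatives of `u` of order greater than `N` set to zero. -/
def jetDt : Derivation ℝ (smoothFunctions Ω) (smoothFunctions Ω) :=
  jetPt Ω + ∑ a : MultiIdx N, jetU Ω a.1.1 (a.1.2 + 1) • jetPd Ω a.1.1 a.1.2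

lemma derivation_sum_apply {ι R : Type*} [CommRing R] [Algebra ℝ R] (s : Finset ι)
    (D : ι → Derivation ℝ R R) (f : R) : (∑ i ∈ s, D i) f = ∑ i ∈ s, D i f := by
  classical
  induction s using Finset.induction_on with
  | empty => simp
  | insert a s ha ih => rw [Finset.sum_insert ha, Finset.sum_insert ha, Derivation.add_apply, ih]

variable {Ω}

lemma jetDx_apply (f : smoothFunctions Ω) : jetDx Ω f =
    jetPx Ω f + ∑ a : MultiIdx N, jetU Ω (a.1.1 + 1) a.1.2 * jetPd Ω a.1.1 a.1.2 f := by
  rw [jetDx, Derivation.add_apply, derivation_sum_apply]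
  rfl

lemma jetDt_apply (f : smoothFunctions Ω) : jetDt Ω f =
    jetPt Ω f + ∑ a : MultiIdx N, jetU Ω a.1.1 (a.1.2 + 1) * jetPd Ω a.1.1 a.1.2 f := by
  rw [jetDt, Derivation.add_apply, derivation_sum_apply]
  rfl

lemma jetPd_jetU (i j k l : ℕ) :
    jetPd Ω i j (jetU Ω k l) = if i = k ∧ j = l ∧ k + l ≤ N then 1 else 0 := by
  rw [jetPd, jetU, directional_ofCLM, jetCoordCLM_jetVec]
  split_ifs <;> simp

lemma jetPd_of_lt {i j : ℕ} (h : N < i + j) (f : smoothFunctions Ω) : jetPd Ω i j f = 0 := by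
  rw [jetPd, jetVec_of_lt h, directional_zero]

lemma jetU_of_lt {i j : ℕ} (h : N < i + j) : jetU Ω i j = 0 := by
  ext z
  exact jetCoordCLM_of_lt h _

lemma jetPx_jetU (k l : ℕ) : jetPx Ω (jetU Ω k l) = 0 := by
  rw [jetPx, jetU, directional_ofCLM]
  by_cases h : k + l ≤ N
  · rw [jetCoordCLM_of_le h]
    exact map_zero _
  · rw [jetCoordCLM_of_lt (by omega), map_zero]

lemma jetPt_jetU (k l : ℕ) : jetPt Ω (jetU Ω k l) = 0 := by
  rw [jetPt, jetU, directional_ofCLM]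
  by_cases h : k + l ≤ N
  · rw [jetCoordCLM_of_le h]
    exact map_zero _
  · rw [jetCoordCLM_of_lt (by omega), map_zero]

lemma jetPd_comm (i j k l : ℕ) (f : smoothFunctions Ω) :
    jetPd Ω i j (jetPd Ω k l f) = jetPd Ω k l (jetPd Ω i j f) := directional_comm _ _ f

lemma jetPx_jetPd (i j : ℕ) (f : smoothFunctions Ω) :
    jetPx Ω (jetPd Ω i j f) = jetPd Ω i j (jetPx Ω f) := directional_comm _ _ f

lemma jetPt_jetPd (i j : ℕ) (f : smoothFunctions Ω) :
    jetPt Ω (jetPd Ω i j f) = jetPd Ω i j (jetPt Ω f) := directional_comm _ _ f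

lemma sum_multiIdx_ite {M : Type*} [AddCommMonoid M] (g : ℕ → ℕ → M) (k l : ℕ) :
    ∑ a : MultiIdx N, (if a.1.1 = k ∧ a.1.2 = l then g a.1.1 a.1.2 else 0) =
      if k + l ≤ N then g k l else 0 := by
  split_ifs with h
  · rw [Finset.sum_eq_single ⟨(k, l), h⟩]
    · simp
    · intro b _ hb
      rw [if_neg]
      rintro ⟨h1, h2⟩
      exact hb (Subtype.ext (Prod.ext h1 h2))
    · simp
  · refine Finset.sum_eq_zero fun a _ => if_neg ?_
    rintro ⟨h1, h2⟩
    have := a.2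
    omega

lemma jetDx_jetU (k l : ℕ) : jetDx Ω (jetU Ω k l) = jetU Ω (k + 1) l := by
  by_cases h : k + l ≤ N
  · rw [jetDx_apply, jetPx_jetU, zero_add]
    simp only [jetPd_jetU, h, and_true, mul_ite, mul_one, mul_zero]
    rw [sum_multiIdx_ite (fun i j => jetU Ω (i + 1) j), if_pos h]
  · rw [jetU_of_lt (by omega), jetU_of_lt (by omega), map_zero]

lemma jetDt_jetU (k l : ℕ) : jetDt Ω (jetU Ω k l) = jetU Ω k (l + 1) := by
  by_cases h : k + l ≤ N
  · rw [jetDt_apply, jetPt_jetU, zero_add]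
    simp only [jetPd_jetU, h, and_true, mul_ite, mul_one, mul_zero]
    rw [sum_multiIdx_ite (fun i j => jetU Ω i (j + 1)), if_pos h]
  · rw [jetU_of_lt (by omega), jetU_of_lt (by omega), map_zero]

lemma jetPd_jetDx (i j : ℕ) (h : i + j ≤ N) (f : smoothFunctions Ω) :
    jetPd Ω i j (jetDx Ω f) =
      jetDx Ω (jetPd Ω i j f) + if i = 0 then 0 else jetPd Ω (i - 1) j f := by
  rw [jetDx_apply, jetDx_apply, map_add, map_sum, jetPx_jetPd, add_assoc]
  congr 1
  simp only [Derivation.leibniz, smul_eq_mul, Finset.sum_add_distrib, jetPd_jetU]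
  congr 1
  · simp only [jetPd_comm i j]
  · simp only [mul_ite, mul_one, mul_zero]
    split_ifs with h0
    · exact Finset.sum_eq_zero fun a _ => if_neg (by omega)
    · rw [Finset.sum_congr rfl (g := fun a : MultiIdx N =>
        if a.1.1 = i - 1 ∧ a.1.2 = j then jetPd Ω a.1.1 a.1.2 f else 0)]
      · rw [sum_multiIdx_ite (fun k l => jetPd Ω k l f), if_pos (by omega)]
      · intro a _
        congr 1
        rw [eq_iff_iff]
        omega

lemma jetPd_jetDt (i j : ℕ) (h : i + j ≤ N) (f : smoothFunctions Ω) :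
    jetPd Ω i j (jetDt Ω f) =
      jetDt Ω (jetPd Ω i j f) + if j = 0 then 0 else jetPd Ω i (j - 1) f := by
  rw [jetDt_apply, jetDt_apply, map_add, map_sum, jetPt_jetPd, add_assoc]
  congr 1
  simp only [Derivation.leibniz, smul_eq_mul, Finset.sum_add_distrib, jetPd_jetU]
  congr 1
  · simp only [jetPd_comm i j]
  · simp only [mul_ite, mul_one, mul_zero]
    split_ifs with h0
    · exact Finset.sum_eq_zero fun a _ => if_neg (by omega)
    · rw [Finset.sum_congr rfl (g := fun a : MultiIdx N =>
        if a.1.1 = i ∧ a.1.2 = j - 1 then jetPd Ω a.1.1 a.1.2 f else 0)]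
      · rw [sum_multiIdx_ite (fun k l => jetPd Ω k l f), if_pos (by omega)]
      · intro a _
        congr 1
        rw [eq_iff_iff]
        omega

/-- Truncation preserves commutation: coordinates beyond order N are zero, so both operators shift
indices on every `jetU`, and partial derivatives commute. -/
lemma jetDx_jetDt (f : smoothFunctions Ω) : jetDx Ω (jetDt Ω f) = jetDt Ω (jetDx Ω f) := by
  have hx : ∀ g : smoothFunctions Ω, jetDx Ω (jetPt Ω g) = jetPt Ω (jetDx Ω g) := by
    intro g
    rw [jetDx_apply, jetDx_apply, map_add, map_sum]
    congr 1
    · exact directional_comm _ _ g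
    · simp [Derivation.leibniz, jetPt_jetU, jetPt_jetPd]
  have ht : ∀ g : smoothFunctions Ω, jetDt Ω (jetPx Ω g) = jetPx Ω (jetDt Ω g) := by
    intro g
    rw [jetDt_apply, jetDt_apply, map_add, map_sum]
    congr 1
    · exact directional_comm _ _ g
    · simp [Derivation.leibniz, jetPx_jetU, jetPx_jetPd]
  rw [jetDt_apply f, jetDx_apply f, map_add, map_add, map_sum, map_sum, hx, ht]
  simp only [Derivation.leibniz, smul_eq_mul, jetDx_jetU, jetDt_jetU, Finset.sum_add_distrib]
  rw [jetDx_apply f, jetDt_apply f, map_add, map_add, map_sum, map_sum]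
  simp only [Derivation.leibniz, smul_eq_mul, jetPx_jetU, jetPt_jetU, mul_zero, add_zero,
    jetDx_apply (jetPd Ω _ _ f), jetDt_apply (jetPd Ω _ _ f), mul_add, Finset.sum_add_distrib,
    Finset.mul_sum, jetPx_jetPd, jetPt_jetPd]
  rw [Finset.sum_comm (γ := MultiIdx N)]
  have hc : jetPx Ω (jetPt Ω f) = jetPt Ω (jetPx Ω f) := directional_comm _ _ f
  have hs : ∀ a b : MultiIdx N,
      jetU Ω b.1.1 (b.1.2 + 1) * (jetU Ω (a.1.1 + 1) a.1.2
        * jetPd Ω a.1.1 a.1.2 (jetPd Ω b.1.1 b.1.2 f)) =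
      jetU Ω (a.1.1 + 1) a.1.2 * (jetU Ω b.1.1 (b.1.2 + 1)
        * jetPd Ω b.1.1 b.1.2 (jetPd Ω a.1.1 a.1.2 f)) := by
    intro a b
    rw [jetPd_comm]
    ring
  simp only [hs, hc, mul_comm (jetPd Ω _ _ f)]
  ring

end JetSpace

section JetCalculusInstance

variable {N : ℕ} {Ω : TopologicalSpace.Opens (Jet N)}

lemma sum_multiIdx_of_vanish {M : Type*} [AddCommMonoid M] (hN : 2 ≤ N) (g : ℕ → ℕ → M)
    (hg : ∀ i j, 3 ≤ i + j → g i j = 0) :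
    ∑ a : MultiIdx N, g a.1.1 a.1.2 = g 0 0 + g 1 0 + g 0 1 + g 2 0 + g 1 1 + g 0 2 := by
  rw [Finset.sum_of_injOn (t := Finset.range (N + 1) ×ˢ Finset.range (N + 1))
    (g := fun a : ℕ × ℕ => g a.1 a.2) (fun a : MultiIdx N => (a : ℕ × ℕ))
    (fun a _ b _ h => Subtype.ext h) (fun a _ => by
      have := a.2
      simp only [Finset.coe_product, Set.mem_prod, Finset.coe_range, Set.mem_Iio]
      omega) (fun a _ ha => by
      refine hg _ _ ?_
      by_contra h
      exact ha ⟨⟨a, by omega⟩, by simp, rfl⟩) (fun a _ => rfl),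
    ← Finset.sum_subset (s₁ := Finset.range 3 ×ˢ Finset.range 3)
      (Finset.product_subset_product (Finset.range_mono (by omega))
        (Finset.range_mono (by omega))) (fun a _ ha => hg _ _ (by
          simp only [Finset.mem_product, Finset.mem_range] at ha
          omega))]
  simp [Finset.sum_product, Finset.sum_range_succ, hg 1 2, hg 2 1, hg 2 2]
  abel

/-- The algebra of smooth functions on an open set of the jet space of order at least six is a
calculus of differential functions. -/
def jetCalculus (hN : 6 ≤ N) (Ω : TopologicalSpace.Opens (Jet N)) :
    JetCalculus (smoothFunctions Ω) where
  u := jetU Ω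
  pd := jetPd Ω
  px := jetPx Ω
  pt := jetPt Ω
  Dx := jetDx Ω
  Dt := jetDt Ω
  pd_comm := jetPd_comm
  px_pd := jetPx_jetPd
  pt_pd := jetPt_jetPd
  pt_px := fun f => directional_comm _ _ f
  pd_u := fun i j k l h => by
    rw [jetPd_jetU]
    simp [h.trans hN]
  px_u := jetPx_jetU
  pt_u := jetPt_jetU
  Dx_u := fun i j _ => jetDx_jetU i j
  Dt_u := fun i j _ => jetDt_jetU i j
  pd_Dx := fun i j f h => jetPd_jetDx i j (h.trans hN) f
  pd_Dt := fun i j f h => jetPd_jetDt i j (h.trans hN) f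
  Dx_eq := fun f hf => by
    rw [jetDx_apply, sum_multiIdx_of_vanish (by omega)
      (fun i j => jetU Ω (i + 1) j * jetPd Ω i j f) (fun i j h => by rw [hf i j h, mul_zero])]
    ring
  Dt_eq := fun f hf => by
    rw [jetDt_apply, sum_multiIdx_of_vanish (by omega)
      (fun i j => jetU Ω i (j + 1) * jetPd Ω i j f) (fun i j h => by rw [hf i j h, mul_zero])]
    ring

end JetCalculusInstance

/-! ### The Euler operator annihilates total divergences. -/

section Euler

variable {N : ℕ} (Ω : TopologicalSpace.Opens (Jet N))

/-- The operator `-D_x`. -/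
def negDx : Module.End ℝ (smoothFunctions Ω) := -(jetDx Ω : smoothFunctions Ω →ₗ[ℝ] _)

/-- The operator `-D_t`. -/
def negDt : Module.End ℝ (smoothFunctions Ω) := -(jetDt Ω : smoothFunctions Ω →ₗ[ℝ] _)

variable {Ω}

lemma negDx_apply (f : smoothFunctions Ω) : negDx Ω f = -jetDx Ω f := rfl

lemma negDt_apply (f : smoothFunctions Ω) : negDt Ω f = -jetDt Ω f := rfl

lemma commute_negDx_negDt : Commute (negDx Ω) (negDt Ω) := by
  refine LinearMap.ext fun f => ?_
  simp [Module.End.mul_apply, negDx_apply, negDt_apply, jetDx_jetDt]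

/-- The Euler operator. -/
def euler (f : smoothFunctions Ω) : smoothFunctions Ω :=
  ∑ i ∈ Finset.range (N + 1), ∑ j ∈ Finset.range (N + 1),
    (negDx Ω ^ i * negDt Ω ^ j) (jetPd Ω i j f)

lemma euler_add (f g : smoothFunctions Ω) : euler (f + g) = euler f + euler g := by
  simp only [euler, map_add, Finset.sum_add_distrib]

/-- The commutation rule of ∂_{u_ij} with D_x makes the sum over i telescope. The hypothesis that f
has order below N kills the end term and the indices of order above N, where the rule fails in
general. -/
lemma euler_jetDx {f : smoothFunctions Ω} (hf : ∀ i j, N ≤ i + j → jetPd Ω i j f = 0) :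
    euler (jetDx Ω f) = 0 := by
  have hpd : ∀ i j, jetPd Ω i j (jetDx Ω f) =
      jetDx Ω (jetPd Ω i j f) + if i = 0 then 0 else jetPd Ω (i - 1) j f := by
    intro i j
    by_cases h : i + j ≤ N
    · exact jetPd_jetDx i j h f
    · rw [jetPd_of_lt (by omega), jetPd_of_lt (by omega), hf (i - 1) j (by omega)]
      simp
  rw [euler, Finset.sum_comm]
  refine Finset.sum_eq_zero fun j _ => ?_
  have h := Finset.sum_range_sub' (fun i => if i = 0 then 0 else
    (negDx Ω ^ i * negDt Ω ^ j) (jetPd Ω (i - 1) j f)) (N + 1)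
  simp only [if_true, Nat.add_one_ne_zero, if_false, Nat.add_sub_cancel, hf N j (by omega),
    map_zero, sub_zero] at h
  rw [← h]
  refine Finset.sum_congr rfl fun i _ => ?_
  rw [hpd, map_add, pow_succ, mul_assoc, (commute_negDx_negDt.pow_right j).eq, ← mul_assoc,
    Module.End.mul_apply (_ * _) (negDx Ω), negDx_apply, map_neg, sub_neg_eq_add, add_comm]
  split_ifs <;> simp

lemma euler_jetDt {f : smoothFunctions Ω} (hf : ∀ i j, N ≤ i + j → jetPd Ω i j f = 0) :
    euler (jetDt Ω f) = 0 := by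
  have hpd : ∀ i j, jetPd Ω i j (jetDt Ω f) =
      jetDt Ω (jetPd Ω i j f) + if j = 0 then 0 else jetPd Ω i (j - 1) f := by
    intro i j
    by_cases h : i + j ≤ N
    · exact jetPd_jetDt i j h f
    · rw [jetPd_of_lt (by omega), jetPd_of_lt (by omega), hf i (j - 1) (by omega)]
      simp
  refine Finset.sum_eq_zero fun i _ => ?_
  have h := Finset.sum_range_sub' (fun j => if j = 0 then 0 else
    (negDx Ω ^ i * negDt Ω ^ j) (jetPd Ω i (j - 1) f)) (N + 1)
  simp only [if_true, Nat.add_one_ne_zero, if_false, Nat.add_sub_cancel, hf i N (by omega),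
    map_zero, sub_zero] at h
  rw [← h]
  refine Finset.sum_congr rfl fun j _ => ?_
  rw [hpd, map_add, pow_succ, ← mul_assoc,
    Module.End.mul_apply (_ * _) (negDt Ω), negDt_apply, map_neg, sub_neg_eq_add, add_comm]
  split_ifs <;> simp

lemma sum_range_of_vanish {M : Type*} [AddCommGroup M] {n : ℕ} (hn : 3 ≤ n) (g : ℕ → ℕ → M)
    (hg : ∀ i j, 3 ≤ i + j → ¬(i = 3 ∧ j = 0) → ¬(i = 2 ∧ j = 1) → g i j = 0) :
    ∑ i ∈ Finset.range (n + 1), ∑ j ∈ Finset.range (n + 1), g i j =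
      g 0 0 + g 1 0 + g 0 1 + g 2 0 + g 1 1 + g 0 2 + g 3 0 + g 2 1 := by
  rw [← Finset.sum_product', ← Finset.sum_subset (s₁ := Finset.range 4 ×ˢ Finset.range 4)
      (Finset.product_subset_product (Finset.range_mono (by omega))
        (Finset.range_mono (by omega))) (fun a _ ha => by
          simp only [Finset.mem_product, Finset.mem_range] at ha
          exact hg _ _ (by omega) (by omega) (by omega))]
  simp only [Finset.sum_product, Finset.sum_range_succ, Finset.sum_range_zero, zero_add]
  rw [hg 0 3, hg 1 2, hg 1 3, hg 2 2, hg 2 3, hg 3 1, hg 3 2, hg 3 3]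
  · abel
  all_goals omega

lemma eulerMul_eq_euler (hN : 6 ≤ N) {f : smoothFunctions Ω} (hf : (jetCalculus hN Ω).LowOrder f) :
    (jetCalculus hN Ω).eulerMul f = euler (f * (jetCalculus hN Ω).novikov) := by
  have hpd : ∀ i j, 3 ≤ i + j → ¬(i = 3 ∧ j = 0) → ¬(i = 2 ∧ j = 1) →
      jetPd Ω i j (f * (jetCalculus hN Ω).novikov) = 0 := by
    intro i j h h1 h2
    have h0 : jetPd Ω i j f = 0 := hf i j h
    have hE : jetPd Ω i j (jetCalculus hN Ω).novikov = 0 := by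
      refine ((jetCalculus hN Ω).pd_novikov i j).trans ?_
      simp only [h1, h2, if_false, add_zero]
      rw [if_neg (by omega), if_neg (by omega), if_neg (by omega), if_neg (by omega)]
      simp
    rw [Derivation.leibniz, h0, hE, smul_zero, smul_zero, add_zero]
  simp only [JetCalculus.eulerMul, show (jetCalculus hN Ω).pd = jetPd Ω from rfl,
    show (jetCalculus hN Ω).Dx = jetDx Ω from rfl, show (jetCalculus hN Ω).Dt = jetDt Ω from rfl]
  generalize f * (jetCalculus hN Ω).novikov = G at hpd ⊢
  rw [euler, sum_range_of_vanish (by omega)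
    (fun i j => (negDx Ω ^ i * negDt Ω ^ j) (jetPd Ω i j G))
    (fun i j h h1 h2 => by rw [hpd i j h h1 h2, map_zero])]
  simp only [pow_succ, pow_zero, one_mul, mul_one, Module.End.mul_apply, Module.End.one_apply,
    negDx_apply, negDt_apply, map_neg, neg_neg, sub_eq_add_neg]

end Euler

/-! ### Functions of low order regarded on higher jets. -/

section Pullback

/-- The projection of jets as a continuous linear map. -/
def projCLM {m n : ℕ} (h : m ≤ n) : Jet n →L[ℝ] Jet m :=
  (ContinuousLinearMap.fst ℝ ℝ (ℝ × (MultiIdx n → ℝ))).prod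
    (((ContinuousLinearMap.fst ℝ ℝ (MultiIdx n → ℝ)).comp
      (ContinuousLinearMap.snd ℝ ℝ (ℝ × (MultiIdx n → ℝ)))).prod
    (ContinuousLinearMap.pi fun a : MultiIdx m =>
      (ContinuousLinearMap.proj (R := ℝ) (φ := fun _ : MultiIdx n => ℝ)
        ⟨a.1, a.2.trans h⟩).comp
      ((ContinuousLinearMap.snd ℝ ℝ (MultiIdx n → ℝ)).comp
        (ContinuousLinearMap.snd ℝ ℝ (ℝ × (MultiIdx n → ℝ))))))

lemma projCLM_apply {m n : ℕ} (h : m ≤ n) (z : Jet n) : projCLM h z = z.proj h := rfl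

/-- The jets of order `N` whose part of order `m` lies in the open set `U`. -/
def jetsOver {m N : ℕ} (h : m ≤ N) (U : TopologicalSpace.Opens (Jet m)) :
    TopologicalSpace.Opens (Jet N) :=
  ⟨{z | z.proj h ∈ U}, U.isOpen.preimage (projCLM h).continuous⟩

lemma mem_jetsOver {m N : ℕ} (h : m ≤ N) (U : TopologicalSpace.Opens (Jet m)) (z : Jet N) :
    z ∈ jetsOver h U ↔ z.proj h ∈ U := Iff.rfl

variable {l m N : ℕ} {hl : l ≤ m} {hm : m ≤ N} {U : TopologicalSpace.Opens (Jet l)}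
  {g : Jet m → ℝ}

/-- A function on jets of order `m` as a function on jets of order `N ≥ m`. -/
def pullback (hm : m ≤ N) (g : Jet m → ℝ) (hg : ContDiffOn ℝ ∞ g (jetsOver hl U)) :
    smoothFunctions (jetsOver (hl.trans hm) U) :=
  smoothRestrict (fun z => g (z.proj hm))
    (hg.comp (projCLM hm).contDiff.contDiffOn fun _ hz => hz)

lemma pullback_apply (hg : ContDiffOn ℝ ∞ g (jetsOver hl U)) (z : jetsOver (hl.trans hm) U) :
    (pullback hm g hg : jetsOver (hl.trans hm) U → ℝ) z = g (z.1.proj hm) := rfl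

lemma directional_pullback (hg : ContDiffOn ℝ ∞ g (jetsOver hl U)) (v : Jet N)
    (z : jetsOver (hl.trans hm) U) :
    (directional v (pullback hm g hg) : jetsOver (hl.trans hm) U → ℝ) z =
      fderiv ℝ g (z.1.proj hm) (v.proj hm) := by
  have hd : DifferentiableAt ℝ g (projCLM hm z.1) :=
    (hg.contDiffAt ((jetsOver hl U).isOpen.mem_nhds z.2)).differentiableAt (by simp)
  rw [pullback, directional_smoothRestrict]
  have := fderiv_comp (z : Jet N) hd (projCLM hm).differentiableAt
  rw [ContinuousLinearMap.fderiv] at this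
  exact congrArg (fun L => L v) this

lemma jetPd_pullback_of_lt (hg : ContDiffOn ℝ ∞ g (jetsOver hl U)) {i j : ℕ} (h : m < i + j) :
    jetPd _ i j (pullback hm g hg) = 0 := by
  have hv : (jetVec N i j).proj hm = 0 := by
    by_cases hN : i + j ≤ N
    · rw [jetVec_of_le hN]
      refine Prod.ext rfl (Prod.ext rfl (funext fun a => ?_))
      refine Pi.single_eq_of_ne (fun hc => ?_) 1
      have h1 := a.2
      rw [congrArg Subtype.val hc] at h1
      simp only at h1
      omega
    · rw [jetVec_of_lt (by omega)]
      rfl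
  ext z
  rw [jetPd, directional_pullback, hv, map_zero]
  rfl

lemma sum_smul_jetVec (w : ℕ → ℕ → ℝ) :
    ∑ a : MultiIdx N, w a.1.1 a.1.2 • jetVec N a.1.1 a.1.2 =
      ((0, 0, fun a => w a.1.1 a.1.2) : Jet N) := by
  have h : ∀ a : MultiIdx N, w a.1.1 a.1.2 • jetVec N a.1.1 a.1.2 =
      ((0, 0, Pi.single a (w a.1.1 a.1.2)) : Jet N) := by
    intro a
    rw [jetVec_of_le a.2]
    simp [← Pi.single_smul]
  rw [Finset.sum_congr rfl fun a _ => h a]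
  refine Prod.ext ?_ (Prod.ext ?_ ?_)
  · simp [Prod.fst_sum]
  · simp [Prod.fst_sum, Prod.snd_sum]
  · simp only [Prod.snd_sum]
    exact Finset.univ_sum_single (fun a : MultiIdx N => w a.1.1 a.1.2)

lemma jetDx_eq_directional {Ω : TopologicalSpace.Opens (Jet N)} (f : smoothFunctions Ω) (z : Ω) :
    (jetDx Ω f : Ω → ℝ) z = (directional ((1, 0, fun a =>
      jetCoordCLM N (a.1.1 + 1) a.1.2 (z : Jet N)) : Jet N) f : Ω → ℝ) z := by
  have hv : ((1, 0, fun a => jetCoordCLM N (a.1.1 + 1) a.1.2 (z : Jet N)) : Jet N) =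
      ((1, 0, 0) : Jet N) + ∑ a : MultiIdx N,
        jetCoordCLM N (a.1.1 + 1) a.1.2 (z : Jet N) • jetVec N a.1.1 a.1.2 := by
    rw [sum_smul_jetVec (fun i j => jetCoordCLM N (i + 1) j (z : Jet N))]
    simp
  rw [hv, directional_apply, map_add, map_sum, jetDx_apply]
  simp only [map_smul, smul_eq_mul, Subalgebra.coe_add, Pi.add_apply,
    AddSubmonoidClass.coe_finsetSum, Finset.sum_apply, Subalgebra.coe_mul, Pi.mul_apply]
  rfl

lemma jetDt_eq_directional {Ω : TopologicalSpace.Opens (Jet N)} (f : smoothFunctions Ω) (z : Ω) :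
    (jetDt Ω f : Ω → ℝ) z = (directional ((0, 1, fun a =>
      jetCoordCLM N a.1.1 (a.1.2 + 1) (z : Jet N)) : Jet N) f : Ω → ℝ) z := by
  have hv : ((0, 1, fun a => jetCoordCLM N a.1.1 (a.1.2 + 1) (z : Jet N)) : Jet N) =
      ((0, 1, 0) : Jet N) + ∑ a : MultiIdx N,
        jetCoordCLM N a.1.1 (a.1.2 + 1) (z : Jet N) • jetVec N a.1.1 a.1.2 := by
    rw [sum_smul_jetVec (fun i j => jetCoordCLM N i (j + 1) (z : Jet N))]
    simp
  rw [hv, directional_apply, map_add, map_sum, jetDt_apply]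
  simp only [map_smul, smul_eq_mul, Subalgebra.coe_add, Pi.add_apply,
    AddSubmonoidClass.coe_finsetSum, Finset.sum_apply, Subalgebra.coe_mul, Pi.mul_apply]
  rfl

/-- With m + 1 ≤ N the truncation at order N discards nothing. -/
lemma jetDx_pullback (hm' : m + 1 ≤ N) (hg : ContDiffOn ℝ ∞ g (jetsOver hl U))
    (z : jetsOver (hl.trans hm) U) :
    (jetDx _ (pullback hm g hg) : jetsOver (hl.trans hm) U → ℝ) z =
      totalDx g (z.1.proj hm') := by
  rw [jetDx_eq_directional, directional_pullback]
  refine congrArg (fderiv ℝ g (z.1.proj hm)) (Prod.ext rfl (Prod.ext rfl (funext fun a => ?_)))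
  have := a.2
  exact jetCoordCLM_of_le (show a.1.1 + 1 + a.1.2 ≤ N by omega) _

lemma jetDt_pullback (hm' : m + 1 ≤ N) (hg : ContDiffOn ℝ ∞ g (jetsOver hl U))
    (z : jetsOver (hl.trans hm) U) :
    (jetDt _ (pullback hm g hg) : jetsOver (hl.trans hm) U → ℝ) z =
      totalDt g (z.1.proj hm') := by
  rw [jetDt_eq_directional, directional_pullback]
  refine congrArg (fderiv ℝ g (z.1.proj hm)) (Prod.ext rfl (Prod.ext rfl (funext fun a => ?_)))
  have := a.2
  exact jetCoordCLM_of_le (show a.1.1 + (a.1.2 + 1) ≤ N by omega) _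

end Pullback

/-! ### Characteristics satisfy the determining equations. -/

section Characteristic

/-- `φ` is the characteristic of a conservation law with currents of order `k + 2`. -/
def HasCurrentsOn (U : Set (Jet 2)) (φ : Jet 2 → ℝ) (k : ℕ) : Prop :=
  ∃ C₀ C₁ : Jet (k + 2) → ℝ,
    ContDiffOn ℝ ∞ C₀ {z | z.proj (by omega) ∈ U} ∧
    ContDiffOn ℝ ∞ C₁ {z | z.proj (by omega) ∈ U} ∧
    ∀ z : Jet (k + 2 + 1), z.proj (by omega) ∈ U →
      totalDt C₀ z + totalDx C₁ z = φ (z.proj (by omega)) * eqn (z.proj (by omega))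

variable {N : ℕ} (hN : 6 ≤ N) {U : TopologicalSpace.Opens (Jet 2)} {φ : Jet 2 → ℝ}

lemma novikov_apply {Ω : TopologicalSpace.Opens (Jet N)} (z : Ω) :
    ((jetCalculus hN Ω).novikov : Ω → ℝ) z = eqn (z.1.proj (by omega)) := by
  have hu : ∀ i j (h : i + j ≤ 3), ((jetCalculus hN Ω).u i j : Ω → ℝ) z =
      (z.1.proj (show 3 ≤ N by omega)).d i j h := fun i j h =>
    jetCoordCLM_of_le (by omega) _
  simp only [JetCalculus.novikov, eqn, ← hu]
  simp only [Subalgebra.coe_sub, Subalgebra.coe_add, Subalgebra.coe_mul, Pi.sub_apply,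
    Pi.add_apply, Pi.mul_apply, pow_two, mul_assoc]
  rfl

lemma lowOrder_pullback (hφ : ContDiffOn ℝ ∞ φ (jetsOver le_rfl U)) :
    (jetCalculus hN _).LowOrder (pullback (show 2 ≤ N by omega) φ hφ) :=
  fun _ _ h => jetPd_pullback_of_lt hφ (by omega)

lemma HasCurrentsOn.eulerMul_eq_zero {k : ℕ} (hk : k + 3 ≤ N)
    (hφ : ContDiffOn ℝ ∞ φ (jetsOver le_rfl U)) (h : HasCurrentsOn U φ k) :
    (jetCalculus hN _).eulerMul (pullback (show 2 ≤ N by omega) φ hφ) = 0 := by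
  obtain ⟨C₀, C₁, h₀, h₁, hC⟩ := h
  rw [eulerMul_eq_euler hN (lowOrder_pullback hN hφ)]
  have hl : 2 ≤ k + 2 := by omega
  have hm : k + 2 ≤ N := by omega
  replace h₀ : ContDiffOn ℝ ∞ C₀ (jetsOver hl U) := h₀
  replace h₁ : ContDiffOn ℝ ∞ C₁ (jetsOver hl U) := h₁
  have key : pullback (show 2 ≤ N by omega) φ hφ * (jetCalculus hN _).novikov =
      jetDt _ (pullback hm C₀ h₀) +
        jetDx _ (pullback hm C₁ h₁) := by
    ext z
    rw [Subalgebra.coe_mul, Pi.mul_apply, Subalgebra.coe_add, Pi.add_apply, novikov_apply,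
      jetDt_pullback hk, jetDx_pullback hk]
    exact (hC (z.1.proj hk) z.2).symm
  rw [key, euler_add, euler_jetDt fun i j hij => jetPd_pullback_of_lt h₀ (by omega),
    euler_jetDx fun i j hij => jetPd_pullback_of_lt h₁ (by omega), add_zero]

end Characteristic

/-! ### Pointwise evaluation and exponentials in x. -/

section Evaluation

variable {N : ℕ} {Ω : TopologicalSpace.Opens (Jet N)}

/-- Evaluation at a point. -/
def evalAt (z : Ω) : smoothFunctions Ω →ₐ[ℝ] ℝ :=
  (Pi.evalAlgHom ℝ (fun _ : Ω => ℝ) z).comp (smoothFunctions Ω).val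

lemma evalAt_apply (z : Ω) (f : smoothFunctions Ω) : evalAt z f = (f : Ω → ℝ) z := rfl

lemma eq_of_evalAt {f g : smoothFunctions Ω} (h : ∀ z, evalAt z f = evalAt z g) : f = g :=
  Subtype.ext (funext h)

lemma evalAt_ofNat (z : Ω) (n : ℕ) [n.AtLeastTwo] :
    evalAt z (ofNat(n) : smoothFunctions Ω) = ofNat(n) := map_ofNat (evalAt z) n

lemma evalAt_jetU {m i j : ℕ} (hm : m ≤ N) (h : i + j ≤ m) (z : Ω) :
    evalAt z (jetU Ω i j) = (z.1.proj hm).d i j h :=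
  jetCoordCLM_of_le (by omega) _

variable (Ω) in
/-- The function `e^{cx}`. -/
def expX (c : ℝ) : smoothFunctions Ω :=
  smoothRestrict (fun z => Real.exp (c * z.1)) (by fun_prop)

lemma evalAt_expX (c : ℝ) (z : Ω) : evalAt z (expX Ω c) = Real.exp (c * z.1.1) := rfl

lemma directional_expX (c : ℝ) (v : Jet N) :
    directional v (expX Ω c) = (c * v.1) • expX Ω c := by
  refine eq_of_evalAt fun z => ?_
  rw [map_smul, evalAt_expX, evalAt_apply, expX, directional_smoothRestrict]
  have h : HasFDerivAt (fun z : Jet N => Real.exp (c * z.1))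
      (Real.exp (c * z.1.1) • c • ContinuousLinearMap.fst ℝ ℝ (ℝ × (MultiIdx N → ℝ))) z.1 :=
    (hasFDerivAt_fst.const_mul c).exp
  rw [h.fderiv]
  simp
  ring

lemma jetPd_expX (c : ℝ) (i j : ℕ) : jetPd Ω i j (expX Ω c) = 0 := by
  have h : (jetVec N i j).1 = 0 := by
    unfold jetVec
    split_ifs <;> rfl
  rw [jetPd, directional_expX, h, mul_zero, zero_smul]

lemma jetPx_expX (c : ℝ) : jetPx Ω (expX Ω c) = c • expX Ω c := by
  rw [jetPx, directional_expX, mul_one]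

lemma jetPt_expX (c : ℝ) : jetPt Ω (expX Ω c) = 0 := by
  rw [jetPt, directional_expX, mul_zero, zero_smul]

lemma expX_mul (c d : ℝ) : expX Ω c * expX Ω d = expX Ω (c + d) := by
  refine eq_of_evalAt fun z => ?_
  rw [map_mul, evalAt_expX, evalAt_expX, evalAt_expX, ← Real.exp_add, add_mul]

lemma expX_zero : expX Ω 0 = 1 := by
  refine eq_of_evalAt fun z => ?_
  rw [evalAt_expX, zero_mul, Real.exp_zero, map_one]

end Evaluation

/-! ### Functions with vanishing derivatives on a connected domain. -/

section Constant

/-- The jet of order `N` with given part of order `m` and vanishing higher derivatives. -/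
def liftCLM (m N : ℕ) : Jet m →L[ℝ] Jet N :=
  (ContinuousLinearMap.fst ℝ ℝ (ℝ × (MultiIdx m → ℝ))).prod
    (((ContinuousLinearMap.fst ℝ ℝ (MultiIdx m → ℝ)).comp
      (ContinuousLinearMap.snd ℝ ℝ (ℝ × (MultiIdx m → ℝ)))).prod
    (ContinuousLinearMap.pi fun a : MultiIdx N => jetCoordCLM m a.1.1 a.1.2))

lemma proj_liftCLM {m N : ℕ} (h : m ≤ N) (z : Jet m) : (liftCLM m N z).proj h = z :=
  Prod.ext rfl (Prod.ext rfl (funext fun a => jetCoordCLM_of_le a.2 z))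

lemma isPreconnected_jetsOver {m N : ℕ} (h : m ≤ N) {U : TopologicalSpace.Opens (Jet m)}
    (hU : IsPreconnected (U : Set (Jet m))) : IsPreconnected (jetsOver h U : Set (Jet N)) := by
  -- The map replaces the order m part of the second jet by the first jet, which exhibits the domain
  -- as a continuous image of U times a vector space.
  have him : (fun p : Jet m × Jet N => p.2 + liftCLM m N (p.1 - projCLM h p.2)) ''
      ((U : Set (Jet m)) ×ˢ Set.univ) = (jetsOver h U : Set (Jet N)) := by
    ext z
    constructor
    · rintro ⟨p, ⟨hp, -⟩, rfl⟩
      have : projCLM h (p.2 + liftCLM m N (p.1 - projCLM h p.2)) = p.1 := by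
        rw [map_add, projCLM_apply h (liftCLM m N _), proj_liftCLM, add_sub_cancel]
      change projCLM h (p.2 + liftCLM m N (p.1 - projCLM h p.2)) ∈ U
      rwa [this]
    · intro hz
      refine ⟨(projCLM h z, z), ⟨hz, trivial⟩, ?_⟩
      simp
  rw [← him]
  exact (hU.prod isPreconnected_univ).image _ (Continuous.continuousOn (by fun_prop))

lemma exists_eq_algebraMap_of_isConstant {N : ℕ} (hN : 6 ≤ N)
    {Ω : TopologicalSpace.Opens (Jet N)} (hΩ : IsPreconnected (Ω : Set (Jet N)))
    {f : smoothFunctions Ω} (hf : (jetCalculus hN Ω).IsConstant f) :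
    ∃ c : ℝ, f = algebraMap ℝ _ c := by
  obtain ⟨hpd, hpx, hpt⟩ := hf
  have hdir : ∀ v : Jet N, ∀ z : Ω,
      fderiv ℝ (extendZero (Ω := (Ω : Set (Jet N))) (f : Ω → ℝ)) z v = 0 := by
    intro v z
    have hv : v = v.1 • ((1, 0, 0) : Jet N) + v.2.1 • ((0, 1, 0) : Jet N)
        + ∑ a : MultiIdx N, jetCoordCLM N a.1.1 a.1.2 v • jetVec N a.1.1 a.1.2 := by
      rw [sum_smul_jetVec (fun i j => jetCoordCLM N i j v)]
      refine Prod.ext (by simp) (Prod.ext (by simp) (funext fun a => ?_))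
      simpa using (jetCoordCLM_of_le a.2 v).symm
    have h1 : fderiv ℝ (extendZero (Ω := (Ω : Set (Jet N))) (f : Ω → ℝ)) z (1, 0, 0) = 0 :=
      congrArg (evalAt z) hpx
    have h2 : fderiv ℝ (extendZero (Ω := (Ω : Set (Jet N))) (f : Ω → ℝ)) z (0, 1, 0) = 0 :=
      congrArg (evalAt z) hpt
    have h3 : ∀ i j, fderiv ℝ (extendZero (Ω := (Ω : Set (Jet N))) (f : Ω → ℝ)) z
        (jetVec N i j) = 0 := fun i j => congrArg (evalAt z) (hpd i j)
    rw [hv, map_add, map_add, map_sum]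
    simp only [map_smul, h1, h2, h3, smul_zero, Finset.sum_const_zero, add_zero]
  obtain ⟨c, hc⟩ := Ω.isOpen.exists_is_const_of_fderiv_eq_zero hΩ
    ((contDiffOn_extendZero f).differentiableOn (by simp))
    (fun z hz => ContinuousLinearMap.ext fun v => hdir v ⟨z, hz⟩)
  refine ⟨c, eq_of_evalAt fun z => ?_⟩
  rw [AlgHom.commutes, evalAt_apply]
  exact (extendZero_of_mem (Ω := (Ω : Set (Jet N))) (f : Ω → ℝ) z.2).symm.trans (hc z z.2)

end Constant

/-! ### Every characteristic is a combination of the five. -/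

section Necessity

lemma contDiff_d {n i j : ℕ} (h : i + j ≤ n) : ContDiff ℝ ∞ fun z : Jet n => z.d i j h := by
  unfold Jet.d
  fun_prop

lemma contDiff_listed (i : Fin 5) : ContDiff ℝ ∞ (listed i) := by
  have hd := @contDiff_d 2
  fin_cases i <;> simp [listed]
  · exact contDiff_const
  · fun_prop
  · exact hd _
  · fun_prop (disch := norm_num)
  · fun_prop (disch := norm_num)

variable {N : ℕ} (hN : 6 ≤ N) (h2 : 2 ≤ N) {U : TopologicalSpace.Opens (Jet 2)}

lemma evalAt_u {i j : ℕ} (h : i + j ≤ 2) (z : jetsOver h2 U) :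
    evalAt z ((jetCalculus hN (jetsOver h2 U)).u i j) = (z.1.proj h2).d i j h := evalAt_jetU h2 h z

lemma pullback_listed_three (hl : ContDiffOn ℝ ∞ (listed 3) (jetsOver le_rfl U)) :
    pullback h2 (listed 3) hl = (jetCalculus hN (jetsOver h2 U)).phi₄ := by
  refine eq_of_evalAt fun z => ?_
  rw [evalAt_apply, pullback_apply]
  simp [JetCalculus.phi₄, evalAt_u, listed, evalAt_ofNat]
  ring

lemma pullback_listed_four (hl : ContDiffOn ℝ ∞ (listed 4) (jetsOver le_rfl U)) :
    pullback h2 (listed 4) hl = expX _ (-2) * (jetCalculus hN (jetsOver h2 U)).phi₅ := by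
  refine eq_of_evalAt fun z => ?_
  rw [evalAt_apply, pullback_apply]
  simp [JetCalculus.phi₅, evalAt_u, listed, evalAt_expX, evalAt_ofNat]
  rw [show (z.1.proj h2).1 = z.1.1 from rfl]
  ring

lemma evalAt_linear_combination (c : Fin 5 → ℝ) (z : jetsOver h2 U) :
    evalAt z (c 0 • 1 + c 1 • expX _ 2 + c 2 • (jetCalculus hN (jetsOver h2 U)).u 0 0
      + c 3 • (jetCalculus hN (jetsOver h2 U)).phi₄
      + c 4 • (expX _ (-2) * (jetCalculus hN (jetsOver h2 U)).phi₅)) =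
    ∑ i, c i * listed i (z.1.proj h2) := by
  rw [← pullback_listed_three hN h2 (contDiff_listed 3).contDiffOn,
    ← pullback_listed_four hN h2 (contDiff_listed 4).contDiffOn]
  simp only [map_add, map_smul, map_one, smul_eq_mul]
  rw [Fin.sum_univ_five]
  rfl

theorem exists_eq_sum_listed (hU : IsPreconnected (U : Set (Jet 2)))
    (h₃ : HasCurrentsOn U (listed 3) 0) (h₄ : HasCurrentsOn U (listed 4) 0)
    {φ : Jet 2 → ℝ} (hφ : IsCharacteristicOn U φ) :
    ∃ c : Fin 5 → ℝ, ∀ z ∈ U, φ z = ∑ i, c i * listed i z := by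
  obtain ⟨hφ, k, hk⟩ := hφ
  replace hk : HasCurrentsOn U φ k := hk
  replace hφ : ContDiffOn ℝ ∞ φ (jetsOver le_rfl U) := hφ
  -- Order k + 6 is at least 6, as the calculus requires, and at least k + 3, the order of the
  -- divergence of the currents.
  have hN : 6 ≤ k + 6 := by omega
  have h2 : 2 ≤ k + 6 := by omega
  have hl : ∀ i, ContDiffOn ℝ ∞ (listed i) (jetsOver le_rfl U) :=
    fun i => (contDiff_listed i).contDiffOn
  obtain ⟨c₁, c₂, c₃, c₄, c₅, hc⟩ := JetCalculus.exists_linear_combination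
    (J := jetCalculus hN (jetsOver h2 U)) (lowOrder_pullback hN hφ)
    (hk.eulerMul_eq_zero hN (by omega) hφ)
    (fun f hf => exists_eq_algebraMap_of_isConstant hN (isPreconnected_jetsOver h2 hU) hf)
    (X := expX _ 2) (Y := expX _ (-2)) (by rw [expX_mul, add_neg_cancel, expX_zero])
    (jetPd_expX 2) ((jetPx_expX 2).trans (by rw [Algebra.smul_def]; rfl)) (jetPt_expX 2)
    (jetPd_expX (-2)) ((jetPx_expX (-2)).trans (by rw [Algebra.smul_def]; rfl)) (jetPt_expX (-2))
    (by rw [← pullback_listed_three hN h2 (hl 3)]; exact h₃.eulerMul_eq_zero hN (by omega) (hl 3))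
    (by rw [← pullback_listed_four hN h2 (hl 4)]; exact h₄.eulerMul_eq_zero hN (by omega) (hl 4))
  refine ⟨![c₁, c₂, c₃, c₄, c₅], fun z hz => ?_⟩
  have hz' : liftCLM 2 (k + 6) z ∈ jetsOver h2 U := by
    rw [mem_jetsOver, proj_liftCLM]
    exact hz
  have hev := (congrArg (evalAt ⟨_, hz'⟩) hc).trans
    (evalAt_linear_combination hN h2 ![c₁, c₂, c₃, c₄, c₅] ⟨_, hz'⟩)
  simpa only [evalAt_apply, pullback_apply, proj_liftCLM] using hev

end Necessity

/-! ### Linear independence on a nonempty open set. -/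

section LinearIndependence

theorem linearIndependent_listed {U : TopologicalSpace.Opens (Jet 2)}
    (hU : (U : Set (Jet 2)).Nonempty) :
    LinearIndependent ℝ (fun (i : Fin 5) (z : (U : Set (Jet 2))) => listed i (z : Jet 2)) := by
  rw [Fintype.linearIndependent_iff]
  intro c hc
  have h2 : 2 ≤ 6 := by omega
  have hJ := evalAt_linear_combination le_rfl h2 (U := U) c
  have hJ0 := eq_of_evalAt (g := 0) fun z => (hJ z).trans (by
    simpa [Finset.sum_apply] using congrFun hc ⟨z.1.proj h2, z.2⟩)
  obtain ⟨y, hy⟩ := hU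
  have hy' : liftCLM 2 6 y ∈ jetsOver h2 U := by
    rw [mem_jetsOver, proj_liftCLM]
    exact hy
  have hexp : ∀ (d : ℝ) (a : ℝ), a • expX (jetsOver h2 U) d = 0 → a = 0 := by
    intro d a h
    have := congrArg (evalAt ⟨_, hy'⟩) h
    simpa [evalAt_expX, Real.exp_ne_zero] using this
  have hpd : ∀ d i j, (jetCalculus le_rfl (jetsOver h2 U)).pd i j (expX (jetsOver h2 U) d) = 0 :=
    jetPd_expX
  -- The system is triangular: only φ₅ contains u_t, then only φ₄ contains u_tx, then only u depends
  -- on u, and only e^{2x} on x.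
  have h4 : c 4 = 0 := by
    have := congrArg ((jetCalculus le_rfl (jetsOver h2 U)).pd 0 1) hJ0
    refine hexp (-2) _ ?_
    simpa [JetCalculus.phi₄, JetCalculus.phi₅, JetCalculus.derivation_ofNat,
      (jetCalculus le_rfl (jetsOver h2 U)).pd_u, hpd] using this
  have h3 : c 3 = 0 := by
    have := congrArg ((jetCalculus le_rfl (jetsOver h2 U)).pd 1 1) hJ0
    have h := congrArg (evalAt ⟨_, hy'⟩) this
    simpa [h4, JetCalculus.phi₄, JetCalculus.phi₅, JetCalculus.derivation_ofNat,
      (jetCalculus le_rfl (jetsOver h2 U)).pd_u, hpd] using h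
  have h20 : c 2 = 0 := by
    have := congrArg ((jetCalculus le_rfl (jetsOver h2 U)).pd 0 0) hJ0
    have h := congrArg (evalAt ⟨_, hy'⟩) this
    simpa [h4, h3, (jetCalculus le_rfl (jetsOver h2 U)).pd_u, hpd] using h
  have h1 : c 1 = 0 := by
    have := congrArg (jetPx (jetsOver h2 U)) hJ0
    have h := congrArg (evalAt ⟨_, hy'⟩) this
    simpa [h4, h3, h20, jetPx_expX, evalAt_expX, Real.exp_ne_zero] using h
  have h0 : c 0 = 0 := by
    have h := congrArg (evalAt ⟨_, hy'⟩) hJ0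
    simpa [h4, h3, h20, h1] using h
  intro i
  fin_cases i <;> assumption

end LinearIndependence

/-! ### Explicit conserved currents for the five characteristics. -/

section Currents

variable {U : TopologicalSpace.Opens (Jet 2)}

lemma jetDx_expX {N : ℕ} {Ω : TopologicalSpace.Opens (Jet N)} (c : ℝ) :
    jetDx Ω (expX Ω c) = c • expX Ω c := by
  simp [jetDx_apply, jetPd_expX, jetPx_expX]

lemma jetDt_expX {N : ℕ} {Ω : TopologicalSpace.Opens (Jet N)} (c : ℝ) :
    jetDt Ω (expX Ω c) = 0 := by
  simp [jetDt_apply, jetPd_expX, jetPt_expX]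

lemma HasCurrentsOn.sum {ι : Type*} [Fintype ι] {ψ : ι → Jet 2 → ℝ} {k : ℕ}
    (h : ∀ i, HasCurrentsOn U (ψ i) k) (c : ι → ℝ) :
    HasCurrentsOn U (fun z => ∑ i, c i * ψ i z) k := by
  choose C₀ C₁ h₀ h₁ hC using h
  have hl : 2 ≤ k + 2 := by omega
  have hd : ∀ C : ι → Jet (k + 2) → ℝ,
      (∀ i, ContDiffOn ℝ ∞ (C i) {z | z.proj hl ∈ (U : Set (Jet 2))}) →
      ∀ z : Jet (k + 2), z.proj hl ∈ (U : Set (Jet 2)) →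
      fderiv ℝ (fun y => ∑ i, c i * C i y) z = ∑ i, c i • fderiv ℝ (C i) z := by
    intro C hC z hz
    have hdiff : ∀ i, DifferentiableAt ℝ (C i) z := fun i =>
      ((hC i).contDiffAt ((jetsOver hl U).isOpen.mem_nhds hz)).differentiableAt (by simp)
    rw [fderiv_fun_sum fun i _ => (hdiff i).const_mul (c i)]
    exact Finset.sum_congr rfl fun i _ => fderiv_const_mul (hdiff i) (c i)
  refine ⟨fun z => ∑ i, c i * C₀ i z, fun z => ∑ i, c i * C₁ i z,
    ContDiffOn.sum fun i _ => contDiffOn_const.mul (h₀ i),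
    ContDiffOn.sum fun i _ => contDiffOn_const.mul (h₁ i), fun z hz => ?_⟩
  rw [totalDt, totalDx, hd C₀ h₀ _ hz, hd C₁ h₁ _ hz, Finset.sum_mul]
  simp only [sum_apply, smul_apply, smul_eq_mul,
    ← Finset.sum_add_distrib]
  refine Finset.sum_congr rfl fun i _ => ?_
  rw [mul_assoc, ← hC i z hz, mul_add]
  rfl

/-- Allows currents with integer coefficients, for the multiples 6u, 12φ₄ and 6φ₅. -/
lemma HasCurrentsOn.of_const_mul {φ : Jet 2 → ℝ} {k : ℕ} {c : ℝ} (hc : c ≠ 0)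
    (h : HasCurrentsOn U (fun z => c * φ z) k) : HasCurrentsOn U φ k := by
  have := HasCurrentsOn.sum (ι := Unit) (fun _ => h) (fun _ => c⁻¹)
  simpa [inv_mul_cancel_left₀ hc] using this

variable (U) in
/-- The left-hand side of the equation as a smooth function of third order jets. -/
def eqnFunction : smoothFunctions (jetsOver (show 2 ≤ 3 by omega) U) :=
  smoothRestrict eqn (by
    have hd := @contDiff_d 3
    unfold eqn
    fun_prop (disch := norm_num))

lemma eqnFunction_eq : eqnFunction U = jetU _ 0 1 - jetU _ 2 1
    - (16 * jetU _ 0 0 * jetU _ 1 0 - 8 * jetU _ 1 0 * jetU _ 2 0 + 2 * jetU _ 2 0 ^ 2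
        - 4 * jetU _ 0 0 * jetU _ 3 0 + 2 * jetU _ 1 0 * jetU _ 3 0) := by
  refine eq_of_evalAt fun z => ?_
  have hu : ∀ i j (h : i + j ≤ 3), evalAt z (jetU _ i j) = z.1.d i j h := fun i j h =>
    evalAt_jetU le_rfl h z
  simp [hu, evalAt_ofNat]
  rfl

/-- The currents have order two, so third order jets already carry the whole identity. There it is a
polynomial identity in the coordinates and an exponential, within reach of `ring`. -/
lemma hasCurrentsOn_of_identity
    {f₀ f₁ ψ : smoothFunctions (jetsOver (show 2 ≤ 3 by omega) U)} {C₀ C₁ φ : Jet 2 → ℝ}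
    (hC₀ : ContDiff ℝ ∞ C₀) (hC₁ : ContDiff ℝ ∞ C₁)
    (h₀ : ∀ z, evalAt z f₀ = C₀ (z.1.proj (by omega)))
    (h₁ : ∀ z, evalAt z f₁ = C₁ (z.1.proj (by omega)))
    (hψ : ∀ z, evalAt z ψ = φ (z.1.proj (by omega)))
    (h : jetDt _ f₀ + jetDx _ f₁ = ψ * eqnFunction U) : HasCurrentsOn U φ 0 := by
  have h23 : 2 ≤ 3 := by omega
  refine ⟨C₀, C₁, hC₀.contDiffOn, hC₁.contDiffOn, fun z hz => ?_⟩
  have h₀' : f₀ = pullback h23 C₀ (hl := le_rfl) hC₀.contDiffOn := eq_of_evalAt h₀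
  have h₁' : f₁ = pullback h23 C₁ (hl := le_rfl) hC₁.contDiffOn := eq_of_evalAt h₁
  have hz' : z ∈ jetsOver h23 U := hz
  have key := congrArg (evalAt ⟨z, hz'⟩) h
  rw [map_add, map_mul, hψ, h₀', h₁', evalAt_apply, evalAt_apply, jetDt_pullback le_rfl,
    jetDx_pullback le_rfl] at key
  exact key

/-- The density of the conservation law with characteristic a multiple of `listed 0`. -/
def densityOne {R : Type*} [CommRing R] (u : R) : R :=
  u

/-- The flux of the conservation law with characteristic a multiple of `listed 0`. -/
def fluxOne {R : Type*} [CommRing R] (u p r s : R) : R :=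
  4 * u * r - 8 * u ^ 2 - 2 * p * r + 2 * p ^ 2 - s

/-- The density of the conservation law with characteristic a multiple of `listed 1`,
up to an exponential factor. -/
def densityExpTwo {R : Type*} [CommRing R] (u : R) : R :=
  -(3 * u)

/-- The flux of the conservation law with characteristic a multiple of `listed 1`,
up to an exponential factor. -/
def fluxExpTwo {R : Type*} [CommRing R] (u p q r s : R) : R :=
  -(8 * u * p) + 4 * u * r + 2 * q - 2 * p * r + 4 * p ^ 2 - s

/-- The density of the conservation law with characteristic a multiple of `listed 2`. -/
def densityU {R : Type*} [CommRing R] (u r : R) : R :=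
  -(3 * u * r) + 3 * u ^ 2

/-- The flux of the conservation law with characteristic a multiple of `listed 2`. -/
def fluxU {R : Type*} [CommRing R] (u p q r s : R) : R :=
  -(12 * u * p * r) - 3 * u * s + 24 * u ^ 2 * r - 32 * u ^ 3 + 3 * q * p + 4 * p ^ 3

/-- The density of the conservation law with characteristic a multiple of `listed 3`. -/
def densityFour {R : Type*} [CommRing R] (u p r : R) : R :=
  -(4 * u * p * r) + 6 * u ^ 2 * r - 16 * u ^ 3

/-- The flux of the conservation law with characteristic a multiple of `listed 3`. -/
def fluxFour {R : Type*} [CommRing R] (u p q r s : R) : R :=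
  12 * u * q * p + 4 * u * p * s - 48 * u * p * r ^ 2 + 48 * u * p ^ 2 * r - 24 * u * s * r
    + 96 * u ^ 2 * p * r - 96 * u ^ 2 * p ^ 2 + 42 * u ^ 2 * s + 48 * u ^ 2 * r ^ 2
    - 192 * u ^ 3 * r + 192 * u ^ 4 - 4 * q * p ^ 2 - 3 * q ^ 2 + 12 * p * s * r - 12 * p ^ 2 * s
    + 12 * p ^ 2 * r ^ 2 - 24 * p ^ 3 * r + 12 * p ^ 4 + 3 * s ^ 2

/-- The density of the conservation law with characteristic a multiple of `listed 4`,
up to an exponential factor. -/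
def densityFive {R : Type*} [CommRing R] (u p r : R) : R :=
  12 * u * p * r + 15 * u ^ 2 * r - 38 * u ^ 3

/-- The flux of the conservation law with characteristic a multiple of `listed 4`,
up to an exponential factor. -/
def fluxFive {R : Type*} [CommRing R] (u p q r s : R) : R :=
  -(6 * u * q * p) + 24 * u * q * r + 12 * u * p * s + 48 * u * p * r ^ 2 + 24 * u * p ^ 2 * r
    - 24 * u * p ^ 3 + 24 * u * s * r - 66 * u ^ 2 * q - 132 * u ^ 2 * p * r + 24 * u ^ 2 * p ^ 2
    - 33 * u ^ 2 * s - 48 * u ^ 2 * r ^ 2 + 144 * u ^ 3 * p + 72 * u ^ 3 * r - 12 * q * p * r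
    - 6 * q * s - 3 * q ^ 2 - 12 * p * s * r + 6 * p ^ 2 * s - 12 * p ^ 2 * r ^ 2
    + 12 * p ^ 3 * r - 12 * p ^ 4 - 3 * s ^ 2

lemma hasCurrentsOn_listed_zero : HasCurrentsOn U (listed 0) 0 := by
  refine HasCurrentsOn.of_const_mul (c := 1) (by norm_num) (hasCurrentsOn_of_identity
    (f₀ := densityOne (jetU _ 0 0))
    (f₁ := fluxOne (jetU _ 0 0) (jetU _ 1 0) (jetU _ 2 0) (jetU _ 1 1))
    (ψ := 1)
    (C₀ := fun z => densityOne (z.d 0 0))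
    (C₁ := fun z => fluxOne (z.d 0 0) (z.d 1 0) (z.d 2 0) (z.d 1 1))
    ?_ ?_ ?_ ?_ ?_ ?_)
  · have hd := @contDiff_d 2
    unfold densityOne
    fun_prop (disch := norm_num)
  · have hd := @contDiff_d 2
    unfold fluxOne
    fun_prop (disch := norm_num)
  · intro z
    simp [densityOne, evalAt_jetU (show 2 ≤ 3 by omega), evalAt_ofNat, evalAt_expX, Jet.proj]
  · intro z
    simp [fluxOne, evalAt_jetU (show 2 ≤ 3 by omega), evalAt_ofNat, evalAt_expX, Jet.proj]
  · intro z
    simp [listed, evalAt_jetU (show 2 ≤ 3 by omega), evalAt_ofNat, evalAt_expX, Jet.proj]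
  · rw [eqnFunction_eq]
    simp [densityOne, fluxOne, Derivation.leibniz_pow, JetCalculus.derivation_ofNat,
      jetDx_jetU, jetDt_jetU, jetDx_expX, jetDt_expX, ofNat_smul_eq_nsmul]
    ring

lemma hasCurrentsOn_listed_one : HasCurrentsOn U (listed 1) 0 := by
  refine HasCurrentsOn.of_const_mul (c := 1) (by norm_num) (hasCurrentsOn_of_identity
    (f₀ := expX _ 2 * densityExpTwo (jetU _ 0 0))
    (f₁ := expX _ 2 * fluxExpTwo (jetU _ 0 0) (jetU _ 1 0) (jetU _ 0 1) (jetU _ 2 0) (jetU _ 1 1))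
    (ψ := expX _ 2)
    (C₀ := fun z => Real.exp (2 * z.1) * densityExpTwo (z.d 0 0))
    (C₁ := fun z => Real.exp (2 * z.1) *
      fluxExpTwo (z.d 0 0) (z.d 1 0) (z.d 0 1) (z.d 2 0) (z.d 1 1))
    ?_ ?_ ?_ ?_ ?_ ?_)
  · have hd := @contDiff_d 2
    unfold densityExpTwo
    fun_prop (disch := norm_num)
  · have hd := @contDiff_d 2
    unfold fluxExpTwo
    fun_prop (disch := norm_num)
  · intro z
    simp [densityExpTwo, evalAt_jetU (show 2 ≤ 3 by omega), evalAt_ofNat, evalAt_expX, Jet.proj]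
  · intro z
    simp [fluxExpTwo, evalAt_jetU (show 2 ≤ 3 by omega), evalAt_ofNat, evalAt_expX, Jet.proj]
  · intro z
    simp [listed, evalAt_jetU (show 2 ≤ 3 by omega), evalAt_ofNat, evalAt_expX, Jet.proj]
  · rw [eqnFunction_eq]
    simp [densityExpTwo, fluxExpTwo, Derivation.leibniz_pow, JetCalculus.derivation_ofNat,
      jetDx_jetU, jetDt_jetU, jetDx_expX, jetDt_expX, ofNat_smul_eq_nsmul]
    ring

lemma hasCurrentsOn_listed_two : HasCurrentsOn U (listed 2) 0 := by
  refine HasCurrentsOn.of_const_mul (c := 6) (by norm_num) (hasCurrentsOn_of_identity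
    (f₀ := densityU (jetU _ 0 0) (jetU _ 2 0))
    (f₁ := fluxU (jetU _ 0 0) (jetU _ 1 0) (jetU _ 0 1) (jetU _ 2 0) (jetU _ 1 1))
    (ψ := 6 * jetU _ 0 0)
    (C₀ := fun z => densityU (z.d 0 0) (z.d 2 0))
    (C₁ := fun z => fluxU (z.d 0 0) (z.d 1 0) (z.d 0 1) (z.d 2 0) (z.d 1 1))
    ?_ ?_ ?_ ?_ ?_ ?_)
  · have hd := @contDiff_d 2
    unfold densityU
    fun_prop (disch := norm_num)
  · have hd := @contDiff_d 2
    unfold fluxU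
    fun_prop (disch := norm_num)
  · intro z
    simp [densityU, evalAt_jetU (show 2 ≤ 3 by omega), evalAt_ofNat, evalAt_expX, Jet.proj]
  · intro z
    simp [fluxU, evalAt_jetU (show 2 ≤ 3 by omega), evalAt_ofNat, evalAt_expX, Jet.proj]
  · intro z
    simp [listed, evalAt_jetU (show 2 ≤ 3 by omega), evalAt_ofNat, evalAt_expX, Jet.proj]
  · rw [eqnFunction_eq]
    simp [densityU, fluxU, Derivation.leibniz_pow, JetCalculus.derivation_ofNat,
      jetDx_jetU, jetDt_jetU, jetDx_expX, jetDt_expX, ofNat_smul_eq_nsmul]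
    ring

lemma hasCurrentsOn_listed_three : HasCurrentsOn U (listed 3) 0 := by
  refine HasCurrentsOn.of_const_mul (c := 12) (by norm_num) (hasCurrentsOn_of_identity
    (f₀ := densityFour (jetU _ 0 0) (jetU _ 1 0) (jetU _ 2 0))
    (f₁ := fluxFour (jetU _ 0 0) (jetU _ 1 0) (jetU _ 0 1) (jetU _ 2 0) (jetU _ 1 1))
    (ψ := -48 * jetU _ 0 0 ^ 2 + 12 * jetU _ 1 0 ^ 2 + 24 * jetU _ 0 0 * jetU _ 2 0
      - 12 * jetU _ 1 0 * jetU _ 2 0 - 6 * jetU _ 1 1)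
    (C₀ := fun z => densityFour (z.d 0 0) (z.d 1 0) (z.d 2 0))
    (C₁ := fun z => fluxFour (z.d 0 0) (z.d 1 0) (z.d 0 1) (z.d 2 0) (z.d 1 1))
    ?_ ?_ ?_ ?_ ?_ ?_)
  · have hd := @contDiff_d 2
    unfold densityFour
    fun_prop (disch := norm_num)
  · have hd := @contDiff_d 2
    unfold fluxFour
    fun_prop (disch := norm_num)
  · intro z
    simp [densityFour, evalAt_jetU (show 2 ≤ 3 by omega), evalAt_ofNat, evalAt_expX, Jet.proj]
  · intro z
    simp [fluxFour, evalAt_jetU (show 2 ≤ 3 by omega), evalAt_ofNat, evalAt_expX, Jet.proj]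
  · intro z
    simp [listed, evalAt_jetU (show 2 ≤ 3 by omega), evalAt_ofNat, evalAt_expX, Jet.proj]
    ring
  · rw [eqnFunction_eq]
    simp [densityFour, fluxFour, Derivation.leibniz_pow, JetCalculus.derivation_ofNat,
      jetDx_jetU, jetDt_jetU, jetDx_expX, jetDt_expX, ofNat_smul_eq_nsmul]
    ring

lemma hasCurrentsOn_listed_four : HasCurrentsOn U (listed 4) 0 := by
  refine HasCurrentsOn.of_const_mul (c := 6) (by norm_num) (hasCurrentsOn_of_identity
    (f₀ := expX _ (-2) *
      densityFive (jetU _ 0 0) (jetU _ 1 0) (jetU _ 2 0))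
    (f₁ := expX _ (-2) *
      fluxFive (jetU _ 0 0) (jetU _ 1 0) (jetU _ 0 1) (jetU _ 2 0) (jetU _ 1 1))
    (ψ := expX _ (-2) * (18 * jetU _ 0 0 ^ 2 - 24 * jetU _ 0 0 * jetU _ 1 0 - 6 * jetU _ 1 0 ^ 2
      + 6 * jetU _ 0 1 - 24 * jetU _ 0 0 * jetU _ 2 0 + 12 * jetU _ 1 0 * jetU _ 2 0
      + 6 * jetU _ 1 1))
    (C₀ := fun z => Real.exp (-2 * z.1) *
      densityFive (z.d 0 0) (z.d 1 0) (z.d 2 0))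
    (C₁ := fun z => Real.exp (-2 * z.1) *
      fluxFive (z.d 0 0) (z.d 1 0) (z.d 0 1) (z.d 2 0) (z.d 1 1))
    ?_ ?_ ?_ ?_ ?_ ?_)
  · have hd := @contDiff_d 2
    unfold densityFive
    fun_prop (disch := norm_num)
  · have hd := @contDiff_d 2
    unfold fluxFive
    fun_prop (disch := norm_num)
  · intro z
    simp [densityFive, evalAt_jetU (show 2 ≤ 3 by omega), evalAt_ofNat, evalAt_expX, Jet.proj]
  · intro z
    simp [fluxFive, evalAt_jetU (show 2 ≤ 3 by omega), evalAt_ofNat, evalAt_expX, Jet.proj]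
  · intro z
    simp [listed, evalAt_jetU (show 2 ≤ 3 by omega), evalAt_ofNat, evalAt_expX, Jet.proj]
    ring
  · rw [eqnFunction_eq]
    simp [densityFive, fluxFive, Derivation.leibniz_pow, JetCalculus.derivation_ofNat,
      jetDx_jetU, jetDt_jetU, jetDx_expX, jetDt_expX, ofNat_smul_eq_nsmul]
    ring

theorem hasCurrentsOn_listed (i : Fin 5) : HasCurrentsOn U (listed i) 0 := by
  fin_cases i
  exacts [hasCurrentsOn_listed_zero, hasCurrentsOn_listed_one, hasCurrentsOn_listed_two,
    hasCurrentsOn_listed_three, hasCurrentsOn_listed_four]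

end Currents

end NovikovCL

end

theorem theorem3p1 (U : Set (NovikovCL.Jet 2)) (hUo : IsOpen U) (hUc : IsConnected U) :
    (∀ φ : NovikovCL.Jet 2 → ℝ,
      NovikovCL.IsCharacteristicOn U φ ↔
        ∃ c : Fin 5 → ℝ, ∀ z ∈ U, φ z = ∑ i, c i * NovikovCL.listed i z) ∧
    LinearIndependent ℝ (fun (i : Fin 5) (z : U) => NovikovCL.listed i (z : NovikovCL.Jet 2)) := by
  have hcur : ∀ i, NovikovCL.HasCurrentsOn U (NovikovCL.listed i) 0 :=
    NovikovCL.hasCurrentsOn_listed (U := ⟨U, hUo⟩)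
  refine ⟨fun φ => ⟨fun h => ?_, ?_⟩, ?_⟩
  · exact NovikovCL.exists_eq_sum_listed (U := ⟨U, hUo⟩) hUc.isPreconnected (hcur 3) (hcur 4) h
  · rintro ⟨c, hc⟩
    refine ⟨ContDiffOn.congr (ContDiffOn.sum fun i _ => contDiffOn_const.mul
      (NovikovCL.contDiff_listed i).contDiffOn) hc, 0, ?_⟩
    obtain ⟨C₀, C₁, h₀, h₁, hC⟩ := NovikovCL.HasCurrentsOn.sum (U := ⟨U, hUo⟩) hcur c
    exact ⟨C₀, C₁, h₀, h₁, fun z hz => by rw [hC z hz, hc _ hz]⟩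
  · exact NovikovCL.linearIndependent_listed (U := ⟨U, hUo⟩) hUc.nonempty
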